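/- **Setting.** Let $N\ge 2$, $d,t,l\in\mathbb N$, and consider $N$ qudits of local dimension $d$. For a probability measure $\nu$ on a unitary group $\mathrm U(q)$, let $M_\nu^{(t)}=\mathbb E_{V\sim\nu}\bigl[V^{\otimes t}\otimes (V^{*})^{\otimes t}\bigr]$ ($V^*$ the entrywise complex conjugate) be its $t$-th moment operator, let $M_{\rm Haar}^{(t)}$ be that of the Haar probability measure on $\mathrm U(q)$, and let $$\Delta_\nu^{(t)}=1-\bigl\|M_\nu^{(t)}-M_{\rm Haar}^{(t)}\bigr\|_\infty$$ be the spectral gap, $\|\cdot\|_\infty$ being the operator norm. A *fixed architecture* $A$ of depth $l$ consists of $l$ layers, each of which is a finite set of pairwise disjoint pairs of sites (the positions of its two-qudit gates). $A$ is a *connected block* (of connection depth $l$) if the graph on the $N$ sites, whose edges are the gate positions of all $l$ layers, is connected. $A$ is *complete* if each layer has $\lfloor N/2\rfloor$ gates, and *incomplete* otherwise. To each gate of $A$ an arbitrary probability measure on $\mathrm U(d^2)$ is assigned; $\nu_j$ denotes the law on $\mathrm U(d^N)$ of the $j$-th layer, whose gates are drawn independently from their measures, and $\nu_A=\nu_l*\cdots*\nu_2*\nu_1$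 is the convolution of the layers. Let $\Delta_{\mathrm{loc},\nu_A}^{(t)}$ be the minimum of the spectral gaps (on $\mathrm U(d^2)$) of the two-qudit measures of all gates of $A$. For $m\ge 2$ let $\Delta^{(t)}_{\nu^{\rm H}_{\rm bw}}(m,d)$ be the spectral gap of the two-layer block of the 1D brickwork circuit (open boundary) on $m$ qudits, with gates on $(1,2),(3,4),\dots$ in the first layer and on $(2,3),(4,5),\dots$ in the second, all gates being Haar random on $\mathrm U(d^2)$. Put $$f_{\rm c}=\min_{2\le m\le N}\Delta^{(t)}_{\nu^{\rm H}_{\rm bw}}(m,d),\qquad f_{\rm i}=f_{\rm c}^{\,h},\qquad h=8\bigl\lceil\log_2\lfloor\log_2(N+1)\rfloor\bigr\rceil+1 .$$ **Proposition.** Let $A$ be a connected block of connection depth $l$, with arbitrary two-qudit measures assigned to its gates. Then $$\Delta_{\nu_A}^{(t)}\;\ge\;\bigl(\Delta_{\mathrm{loc},\nu_A}^{(t)}\bigr)^{l}\cdot \mathrm{LB}_A^{(t)},\qquad \mathrm{LB}_A^{(t)}=\begin{cases} f_{\rm c}^{\,l-1} & \text{if } A \text{ is complete},\\ f_{\rm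 i}^{\,l-1} & \text{if } A \text{ is incomplete.}\end{cases}$$ -/

import Mathlib

open MeasureTheory
open scoped MeasureTheory

namespace RandomCircuit

/-! ### Unitary ensembles, moment operators and spectral gaps -/

/-- The unitary group of the Hilbert space with orthonormal basis labelled by `ι`. -/
abbrev U (ι : Type) [Fintype ι] [DecidableEq ι] : Type := Matrix.unitaryGroup ι ℂ

section UnitaryGroup

variable (ι : Type) [Fintype ι] [DecidableEq ι]

noncomputable instance instMeasurableSpaceU : MeasurableSpace (U ι) := borel _

instance instBorelSpaceU : BorelSpace (U ι) := ⟨rfl⟩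

instance instSecondCountableU : SecondCountableTopology (U ι) :=
  haveI : SecondCountableTopology (Matrix ι ι ℂ) :=
    inferInstanceAs (SecondCountableTopology (ι → ι → ℂ))
  TopologicalSpace.Subtype.secondCountableTopology
    {A : Matrix ι ι ℂ | A ∈ Matrix.unitaryGroup ι ℂ}

instance instCompactSpaceU : CompactSpace (U ι) := by
  have hK : IsCompact (Set.pi Set.univ fun _ : ι => Set.pi Set.univ fun _ : ι =>
      Metric.closedBall (0 : ℂ) 1) :=
    isCompact_univ_pi fun _ => isCompact_univ_pi fun _ => isCompact_closedBall _ _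
  have hc : IsClosed {A : Matrix ι ι ℂ | A ∈ Matrix.unitaryGroup ι ℂ} := by
    have : {A : Matrix ι ι ℂ | A ∈ Matrix.unitaryGroup ι ℂ} =
        {A : Matrix ι ι ℂ | A * star A = 1} := by
      ext A
      exact Matrix.mem_unitaryGroup_iff
    rw [this]
    exact isClosed_eq (continuous_id.mul continuous_star) continuous_const
  refine isCompact_iff_compactSpace.mp (hK.of_isClosed_subset hc ?_)
  intro A hA i _ j _
  simpa using entry_norm_bound_of_unitary (𝕜 := ℂ) hA i j

/-- The Haar ensemble: the normalised Haar measure of the (compact) unitary group. -/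
noncomputable def haarEnsemble : ProbabilityMeasure (U ι) :=
  ⟨Measure.haarMeasure ⊤, ⟨by
    simpa using Measure.haarMeasure_self (G := U ι)
      (K₀ := (⊤ : TopologicalSpace.PositiveCompacts (U ι)))⟩⟩

end UnitaryGroup

section Moments

variable {ι : Type} [Fintype ι] [DecidableEq ι]

/-- The matrix `V^{⊗t} ⊗ (V^*)^{⊗t}`, where `V^*` is the entrywise complex conjugate of `V`. -/
def tensorPower (t : ℕ) (V : U ι) :
    Matrix ((Fin t → ι) × (Fin t → ι)) ((Fin t → ι) × (Fin t → ι)) ℂ :=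
  Matrix.of fun a b =>
    (∏ k, (V : Matrix ι ι ℂ) (a.1 k) (b.1 k)) * ∏ k, star ((V : Matrix ι ι ℂ) (a.2 k) (b.2 k))

/-- The `t`-th moment operator `𝔼_{V ∼ ν} [V^{⊗t} ⊗ (V^*)^{⊗t}]`
(an entrywise integral of bounded continuous functions). -/
noncomputable def momentOperator (t : ℕ) (ν : Measure (U ι)) :
    Matrix ((Fin t → ι) × (Fin t → ι)) ((Fin t → ι) × (Fin t → ι)) ℂ :=
  Matrix.of fun a b => ∫ V, tensorPower t V a b ∂ν

/-- The operator norm of a square matrix with respect to the Euclidean (Hilbert space) norm. -/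
noncomputable def opNorm {κ : Type} [Fintype κ] [DecidableEq κ] (M : Matrix κ κ ℂ) : ℝ :=
  ‖Matrix.toEuclideanCLM (n := κ) (𝕜 := ℂ) M‖

/-- The spectral gap `1 - ‖M_ν - M_Haar‖` of a unitary ensemble. -/
noncomputable def spectralGap (t : ℕ) (ν : Measure (U ι)) : ℝ :=
  1 - opNorm (momentOperator t ν - momentOperator t (haarEnsemble ι : Measure (U ι)))

end Moments

/-! ### Fixed architectures -/

/-- A circuit layer on `N` sites: finitely many two-site gate positions without overlaps.
The gate `g` acts on the sites `site (g, 0)` and `site (g, 1)`. -/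
structure Layer (N : ℕ) where
  numGates : ℕ
  site : Fin numGates × Fin 2 → Fin N
  site_injective : Function.Injective site

/-- A fixed architecture of depth `l` on `N` sites; layer `0` is applied first. -/
abbrev Architecture (N l : ℕ) : Type := Fin l → Layer N

namespace Architecture

variable {N l : ℕ}

/-- The graph on the sites whose edges are the gate positions of all layers. -/
def graph (A : Architecture N l) : SimpleGraph (Fin N) :=
  SimpleGraph.fromRel fun x y =>
    ∃ (j : Fin l) (g : Fin (A j).numGates), (A j).site (g, 0) = x ∧ (A j).site (g, 1) = y

/-- The gates of the architecture form a connected graph over all sites. -/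
def IsConnectedBlock (A : Architecture N l) : Prop := A.graph.Connected

/-- Every layer contains the maximal number `⌊N / 2⌋` of gates. -/
def IsComplete (A : Architecture N l) : Prop := ∀ j, (A j).numGates = N / 2

/-- A choice of a two-qudit unitary ensemble for each gate of the architecture. -/
abbrev GateEnsembles (A : Architecture N l) (d : ℕ) : Type :=
  (j : Fin l) → Fin (A j).numGates → ProbabilityMeasure (U (Fin d × Fin d))

end Architecture

/-! ### Circuit ensembles -/

section Circuit

variable {N d : ℕ}

/-- The matrix of `u ⊗ 1` on `N` qudits, with `u` acting on the sites `i`, `j`. -/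
def gateMatrix (i j : Fin N) (u : Matrix (Fin d × Fin d) (Fin d × Fin d) ℂ) :
    Matrix (Fin N → Fin d) (Fin N → Fin d) ℂ :=
  Matrix.of fun x y =>
    if ∀ k, k ≠ i → k ≠ j → x k = y k then u (x i, x j) (y i, y j) else 0

theorem gateMatrix_mem_unitaryGroup {i j : Fin N} (hij : i ≠ j) (u : U (Fin d × Fin d)) :
    gateMatrix i j (u : Matrix (Fin d × Fin d) (Fin d × Fin d) ℂ) ∈
      Matrix.unitaryGroup (Fin N → Fin d) ℂ := by
  rw [Matrix.mem_unitaryGroup_iff]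
  have hu := Matrix.mem_unitaryGroup_iff.mp u.2
  ext x y
  have key : ∑ z, gateMatrix i j u.1 x z * star (gateMatrix i j u.1 y z) =
      ∑ p : Fin d × Fin d, (if ∀ k, k ≠ i → k ≠ j → x k = y k then
        u.1 (x i, x j) p * star (u.1 (y i, y j) p) else 0) := by
    symm
    refine Finset.sum_of_injOn
      (fun p => Function.update (Function.update x i p.1) j p.2) ?_ ?_ ?_ ?_
    · intro p _ q _ h
      have h1 := congrFun h i
      have h2 := congrFun h j
      simp only [Function.update_self, Function.update_of_ne hij] at h1 h2
      exact Prod.ext h1 h2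
    · intro p _
      simp
    · intro z _ hz
      have : ¬ ∀ k, k ≠ i → k ≠ j → x k = z k := by
        intro h
        apply hz
        refine ⟨(z i, z j), by simp, ?_⟩
        funext k
        by_cases hkj : k = j
        · subst hkj; simp
        · by_cases hki : k = i
          · subst hki; simp [Function.update_of_ne hkj]
          · simp [Function.update_of_ne hkj, Function.update_of_ne hki, h k hki hkj]
      simp [gateMatrix, this]
    · intro p _
      have h1 : ∀ k, k ≠ i → k ≠ j →
          Function.update (Function.update x i p.1) j p.2 k = x k := by
        intro k hki hkj
        simp [Function.update_of_ne hkj, Function.update_of_ne hki]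
      have h2 : (∀ k, k ≠ i → k ≠ j →
          x k = Function.update (Function.update x i p.1) j p.2 k) :=
        fun k a b => (h1 k a b).symm
      have h3 : (∀ k, k ≠ i → k ≠ j →
          y k = Function.update (Function.update x i p.1) j p.2 k) ↔
          ∀ k, k ≠ i → k ≠ j → x k = y k :=
        forall_congr' fun k => forall_congr' fun a => forall_congr' fun b => by
          rw [h1 k a b]; exact eq_comm
      simp only [gateMatrix, Matrix.of_apply, if_pos h2, Function.update_self,
        Function.update_of_ne hij]
      by_cases h : ∀ k, k ≠ i → k ≠ j → x k = y k
      · rw [if_pos h, if_pos (h3.mpr h)]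
      · rw [if_neg h, if_neg (fun h' => h (h3.mp h'))]; simp
  rw [Matrix.mul_apply]
  simp only [Matrix.star_apply]
  rw [key]
  have e := congrFun (congrFun hu (x i, x j)) (y i, y j)
  rw [Matrix.mul_apply] at e
  simp only [Matrix.star_apply] at e
  by_cases h : ∀ k, k ≠ i → k ≠ j → x k = y k
  · simp only [if_pos h, e, Matrix.one_apply]
    congr 1
    apply propext
    constructor
    · intro hh
      funext k
      by_cases hki : k = i
      · subst hki; exact (Prod.ext_iff.mp hh).1
      · by_cases hkj : k = j
        · subst hkj; exact (Prod.ext_iff.mp hh).2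
        · exact h k hki hkj
    · rintro rfl; rfl
  · have hxy : x ≠ y := by rintro rfl; exact h fun _ _ _ => rfl
    simp only [if_neg h, Finset.sum_const_zero, Matrix.one_apply, if_neg hxy]

/-- The two-qudit unitary `u`, acting on two different sites of the `N`-qudit system. -/
def embedGate (i j : Fin N) (hij : i ≠ j) (u : U (Fin d × Fin d)) : U (Fin N → Fin d) :=
  ⟨gateMatrix i j u.1, gateMatrix_mem_unitaryGroup hij u⟩

theorem Layer.site_ne (L : Layer N) (g : Fin L.numGates) : L.site (g, 0) ≠ L.site (g, 1) :=
  fun h => by simpa using L.site_injective h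

/-- The unitary of a layer: the product of its gates (they commute, as they do not overlap). -/
def Layer.unitary (L : Layer N) (u : Fin L.numGates → U (Fin d × Fin d)) : U (Fin N → Fin d) :=
  (List.ofFn fun g => embedGate (L.site (g, 0)) (L.site (g, 1)) (L.site_ne g) (u g)).prod

/-- The ensemble of a layer: its gates are drawn independently from their ensembles. -/
noncomputable def Layer.ensemble (L : Layer N)
    (ν : Fin L.numGates → ProbabilityMeasure (U (Fin d × Fin d))) : Measure (U (Fin N → Fin d)) :=
  (Measure.pi fun g => (ν g : Measure (U (Fin d × Fin d)))).map L.unitary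

/-- The ensemble `ν_l * ⋯ * ν_2 * ν_1` of the whole circuit, the (multiplicative) convolution
of the ensembles of its layers. -/
noncomputable def circuitEnsemble {l : ℕ} (A : Architecture N l) (ν : A.GateEnsembles d) :
    Measure (U (Fin N → Fin d)) :=
  (List.ofFn fun j => (A j).ensemble (ν j)).foldl (fun acc μ => μ ∗ₘ acc) (Measure.dirac 1)

/-- The local spectral gap: the minimum of the spectral gaps of all two-qudit ensembles
of the circuit. -/
noncomputable def localSpectralGap {l : ℕ} (t : ℕ) (A : Architecture N l)
    (ν : A.GateEnsembles d) : ℝ :=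
  ⨅ g : (j : Fin l) × Fin (A j).numGates, spectralGap t (ν g.1 g.2 : Measure (U (Fin d × Fin d)))

end Circuit

/-! ### The Haar random brickwork circuit and the Haar lower bounds -/

/-- The two layers of the 1D brickwork on `m` sites (open boundary), numbering the sites from `0`:
gates on `(0,1), (2,3), …`, and then on `(1,2), (3,4), …`. -/
def brickwork (m : ℕ) : Architecture m 2 :=
  ![{ numGates := m / 2
      site := fun p => ⟨2 * p.1 + p.2, by omega⟩
      site_injective := by
        rintro ⟨a, b⟩ ⟨a', b'⟩ h
        simp only [Fin.mk.injEq] at h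
        ext <;> simp only <;> omega },
    { numGates := (m - 1) / 2
      site := fun p => ⟨2 * p.1 + p.2 + 1, by omega⟩
      site_injective := by
        rintro ⟨a, b⟩ ⟨a', b'⟩ h
        simp only [Fin.mk.injEq] at h
        ext <;> simp only <;> omega }]

/-- The spectral gap of the two-layer block of the Haar random 1D brickwork circuit
on `m` qudits of local dimension `d`. -/
noncomputable def haarBrickworkGap (t m d : ℕ) : ℝ :=
  spectralGap t (circuitEnsemble (brickwork m) fun _ _ => haarEnsemble (Fin d × Fin d))

/-- `f_c(N, t, d)`: the minimum over `2 ≤ m ≤ N` of the Haar brickwork gaps on `m` qudits. -/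
noncomputable def fComplete (N t d : ℕ) : ℝ :=
  ⨅ m : Finset.Icc 2 N, haarBrickworkGap t m d

/-- The exponent `h = 8 ⌈log₂ ⌊log₂ (N + 1)⌋⌉ + 1`. -/
def hExponent (N : ℕ) : ℕ := 8 * Nat.clog 2 (Nat.log 2 (N + 1)) + 1

/-- `f_i(N, t, d)`: the same minimum, raised to the power `h`. -/
noncomputable def fIncomplete (N t d : ℕ) : ℝ := fComplete N t d ^ hExponent N

end RandomCircuit

/-!
The moment operator of a Haar random gate is the orthogonal projection onto the vectors fixed by
all gates on its two sites, so a layer of Haar random gates is the projection onto `gateInvariants`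
of a relation between the sites, and a layer of arbitrary gates is a contraction that is close to
this projection (`Layer.norm_average_ensemble_sub_le`). The moment operator of the circuit is the
product of those of the layers. By induction on the depth it is compared with the projection of
the partition of the sites that the gates of all layers generate
(`norm_average_composition_sub_le`). What this needs are two facts: gaps multiply, in the sense of
`norm_mul_sub_le_of_right` and `norm_mul_sub_le_of_left`, and the projections `Π p`, `Π q` of the
partition `p` of a single layer and of the partition `q` of the earlier layers satisfy
`‖Π p * Π q - Π (p ⊔ q)‖ ≤ 1 - f`, where `f` is the bound to be proved for one layer. The
partition of a connected block has only one class, for which the projection is the Haar moment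
operator.

If `p` and `q` are replaced by finer partitions into pairs and single sites, that is, by
involutions `α` and `β`, then the orbits of `α` and `β` are paths or cycles. Along such an orbit
the gates form a brickwork on `m` sites (plus one gate that closes the cycle), and different orbits
act on different sites, so the gap is at least `fComplete` (`norm_involutions_le`). Replacing `p`
and `q` by finer partitions is harmless as long as the join stays the same
(`norm_gateProj_mul_sub_mono`). It therefore remains to find `α` below `p` and `β` below `q` whose
orbits are the classes of `p ⊔ q`. By a parity argument this is possible if `p` and `q` have
pairings that leave out at most three sites of each class of `p ⊔ q` altogether
(`exists_link_eq_sup`): orbits of a class that are not yet joined are merged by exchanging partners.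
In complete architectures all layers leave out at most one site, which gives `f = fComplete`.
For an incomplete layer, three such pairs of pairings in succession are enough
(`exists_three_pairings`), so `f = fComplete ^ 3` is possible, and the exponent in `fIncomplete` is
at least `3` for three or more sites. On two sites any two partitions are comparable and the
projections multiply exactly.

That all gates on the edges of a path generate the same fixed vectors as all unitaries is not proved
as a universality statement: it follows from `0 < fComplete` (`gateInvariants_path_le`). If
`fComplete = 0`, the claim is trivial for two or more layers, and a single connected layer consists
of one gate on two sites (`Architecture.IsConnectedBlock.gateInvariants_eq`).
-/

namespace RandomCircuit

/-! ### Orthogonal projections and contractions on a Hilbert space -/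

section Hilbert

theorem norm_mul_apply_le_of_norm_le_one {E : Type*} [NormedAddCommGroup E]
    [InnerProductSpace ℂ E] {Y : E →L[ℂ] E} (hY : ‖Y‖ ≤ 1) (x : E) : ‖Y x‖ ≤ ‖x‖ :=
  (Y.le_of_opNorm_le hY x).trans_eq (one_mul _)

variable {E : Type*} [NormedAddCommGroup E] [InnerProductSpace ℂ E] [FiniteDimensional ℂ E]

theorem starProjection_mul_of_le {K L : Submodule ℂ E} (h : K ≤ L) :
    L.starProjection * K.starProjection = K.starProjection := by
  ext x
  exact Submodule.starProjection_eq_self_iff.2 (h (K.starProjection_apply_mem x))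

theorem starProjection_mul_of_ge {K L : Submodule ℂ E} (h : K ≤ L) :
    K.starProjection * L.starProjection = K.starProjection := by
  ext x
  refine (Submodule.eq_starProjection_of_mem_orthogonal (K.starProjection_apply_mem _) ?_).symm
  have h1 : L.starProjection x - K.starProjection (L.starProjection x) ∈ Kᗮ :=
    K.sub_starProjection_mem_orthogonal _
  have h2 : x - L.starProjection x ∈ Kᗮ :=
    Submodule.orthogonal_le h (L.sub_starProjection_mem_orthogonal _)
  simpa using Kᗮ.add_mem h2 h1

theorem starProjection_mul_self (K : Submodule ℂ E) :
    K.starProjection * K.starProjection = K.starProjection :=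
  starProjection_mul_of_le le_rfl

theorem norm_starProjection_le_one (K : Submodule ℂ E) : ‖K.starProjection‖ ≤ 1 :=
  K.starProjection_norm_le

theorem starProjection_mul_eq_inf {K L M : Submodule ℂ E}
    (h : Commute K.starProjection L.starProjection) (hM : M = K ⊓ L) :
    K.starProjection * L.starProjection = M.starProjection := by
  subst hM
  ext x
  symm
  refine Submodule.eq_starProjection_of_mem_orthogonal ⟨K.starProjection_apply_mem _, ?_⟩ ?_
  · rw [h.eq]
    exact L.starProjection_apply_mem _
  · have h1 : x - K.starProjection x ∈ (K ⊓ L)ᗮ :=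
      Submodule.orthogonal_le inf_le_left (K.sub_starProjection_mem_orthogonal _)
    have h2 : K.starProjection (x - L.starProjection x) ∈ (K ⊓ L)ᗮ := by
      intro w hw
      rw [← Submodule.inner_starProjection_left_eq_right,
        Submodule.starProjection_eq_self_iff.2 hw.1]
      exact L.sub_starProjection_mem_orthogonal x w hw.2
    simpa using Submodule.add_mem _ h1 h2

/-- An operator commutes with an orthogonal projection as soon as it and its adjoint preserve
the range. -/
theorem commute_starProjection {A : E →L[ℂ] E} {K : Submodule ℂ E} (h : ∀ x ∈ K, A x ∈ K)
    (h' : ∀ x ∈ K, A.adjoint x ∈ K) : Commute A K.starProjection := by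
  ext x
  symm
  refine Submodule.eq_starProjection_of_mem_orthogonal (h _ (K.starProjection_apply_mem _)) ?_
  intro w hw
  change inner ℂ w (A x - A (K.starProjection x)) = 0
  rw [← map_sub, ← ContinuousLinearMap.adjoint_inner_left]
  exact K.sub_starProjection_mem_orthogonal x _ (h' w hw)

theorem norm_add_le_of_inner_eq_zero {A B : E →L[ℂ] E} {K : Submodule ℂ E} {ε : ℝ} (hε : 0 ≤ ε)
    (hA : ∀ x, ‖A x‖ ≤ ε * ‖x - K.starProjection x‖) (hB : ∀ x, ‖B x‖ ≤ ε * ‖K.starProjection x‖)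
    (hAB : ∀ x, inner ℂ (A x) (B x) = 0) : ‖A + B‖ ≤ ε := by
  refine ContinuousLinearMap.opNorm_le_bound _ hε fun x => ?_
  refine le_of_sq_le_sq ?_ (by positivity)
  have h1 : ‖A x + B x‖ ^ 2 = ‖A x‖ ^ 2 + ‖B x‖ ^ 2 := by
    simpa [sq] using norm_add_sq_eq_norm_sq_add_norm_sq_of_inner_eq_zero (A x) (B x) (hAB x)
  have h2 : ‖x‖ ^ 2 = ‖x - K.starProjection x‖ ^ 2 + ‖K.starProjection x‖ ^ 2 := by
    have : inner ℂ (x - K.starProjection x) (K.starProjection x) = 0 :=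
      Submodule.inner_left_of_mem_orthogonal (K.starProjection_apply_mem _)
        (K.sub_starProjection_mem_orthogonal _)
    simpa [sq] using norm_add_sq_eq_norm_sq_add_norm_sq_of_inner_eq_zero _ _ this
  calc ‖(A + B) x‖ ^ 2 = ‖A x‖ ^ 2 + ‖B x‖ ^ 2 := h1
    _ ≤ (ε * ‖x - K.starProjection x‖) ^ 2 + (ε * ‖K.starProjection x‖) ^ 2 := by
        gcongr
        exacts [hA x, hB x]
    _ = (ε * ‖x‖) ^ 2 := by rw [mul_pow, mul_pow, mul_pow, h2]; ring

/-- Two commuting contractions `X`, `Y` which are `ε`-close to commuting projections onto fixed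
vectors: their product is just as close to the product of the projections. The vectors not fixed
by the first projection and those fixed by the first but not by the second are treated
separately, and both parts stay orthogonal. -/
theorem norm_mul_sub_mul_le {X Y : E →L[ℂ] E} {K L : Submodule ℂ E} {ε : ℝ} (hε : 0 ≤ ε)
    (hXY : Commute X Y) (hKY : Commute K.starProjection Y)
    (hKL : Commute K.starProjection L.starProjection)
    (hX₁ : X * K.starProjection = K.starProjection) (hX₂ : K.starProjection * X = K.starProjection)
    (hY : ‖Y‖ ≤ 1)
    (hX' : ‖X - K.starProjection‖ ≤ ε) (hY' : ‖Y - L.starProjection‖ ≤ ε) :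
    ‖X * Y - K.starProjection * L.starProjection‖ ≤ ε := by
  set P := K.starProjection with hP
  set Q := L.starProjection with hQ
  have hPP : P * P = P := starProjection_mul_self K
  have e1 : X * Y - P * Q = Y * (X - P) + P * (Y - Q) := by
    rw [mul_sub, mul_sub, hXY.eq, hKY.eq]; abel
  rw [e1]
  refine norm_add_le_of_inner_eq_zero (K := K) hε (fun x => ?_) (fun x => ?_) (fun x => ?_)
  · have : (X - P) x = (X - P) (x - P x) := by
      have h1 := congr($hX₁ x)
      have h2 := congr($hPP x)
      simp only [mul_apply_eq_comp] at h1 h2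
      simp [h1, h2]
    rw [mul_apply_eq_comp, this]
    exact (norm_mul_apply_le_of_norm_le_one hY _).trans (ContinuousLinearMap.le_of_opNorm_le _ hX' _)
  · have : P * (Y - Q) = P * ((Y - Q) * P) := by
      have hc : Commute P (Y - Q) := hKY.sub_right hKL
      rw [← hc.eq, ← mul_assoc, hPP]
    rw [this, mul_apply_eq_comp]
    refine (norm_mul_apply_le_of_norm_le_one (norm_starProjection_le_one K) _).trans ?_
    exact ContinuousLinearMap.le_of_opNorm_le _ hY' _
  · rw [mul_apply_eq_comp P, hP, ← Submodule.inner_starProjection_left_eq_right, ← hP]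
    have : P * (Y * (X - P)) = 0 := by
      rw [← mul_assoc, hKY.eq, mul_assoc, mul_sub, hX₂, hPP, sub_self, mul_zero]
    have h := congr($this x)
    simp only [mul_apply_eq_comp, zero_apply] at h ⊢
    rw [h, inner_zero_left]

/-- A contraction at distance at most `1 - f` from the projection onto its fixed vectors `K` is a
mixture, with weights `f` and `1 - f`, of that projection and of a contraction. From the latter, the
projection onto a subspace `M` of `K` is split off. -/
theorem norm_sub_smul_sub_smul_le {X : E →L[ℂ] E} {K M : Submodule ℂ E} {f : ℝ} (hf : f ≤ 1)
    (hX₁ : X * K.starProjection = K.starProjection) (hX₂ : K.starProjection * X = K.starProjection)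
    (hMK : M ≤ K) (hX : ‖X - K.starProjection‖ ≤ 1 - f) :
    ‖X - (f : ℂ) • K.starProjection - ((1 - f : ℝ) : ℂ) • M.starProjection‖ ≤ 1 - f := by
  set P := K.starProjection with hP
  set Z := M.starProjection with hZ
  have hPP : P * P = P := starProjection_mul_self K
  have hZP : Z * P = Z := starProjection_mul_of_ge hMK
  have hPZ : P * Z = Z := starProjection_mul_of_le hMK
  have e1 : X - (f : ℂ) • P - ((1 - f : ℝ) : ℂ) • Z = (X - P) + ((1 - f : ℝ) : ℂ) • (P - Z) := by
    push_cast
    module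
  rw [e1]
  refine norm_add_le_of_inner_eq_zero (K := K) (by linarith) (fun x => ?_) (fun x => ?_)
    (fun x => ?_)
  · have : (X - P) x = (X - P) (x - P x) := by
      have h1 := congr($hX₁ x)
      have h2 := congr($hPP x)
      simp only [mul_apply_eq_comp] at h1 h2
      simp [h1, h2]
    rw [this]
    exact ContinuousLinearMap.le_of_opNorm_le _ hX _
  · have h1 : P - Z = (1 - Z) * P := by rw [sub_mul, one_mul, hZP]
    have h2 : ‖(1 - Z) (P x)‖ ≤ ‖P x‖ := by
      have := M.norm_sq_eq_add_norm_sq_starProjection (P x)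
      rw [Submodule.starProjection_orthogonal' M] at this
      refine le_of_sq_le_sq ?_ (norm_nonneg _)
      nlinarith [sq_nonneg ‖M.starProjection (P x)‖]
    rw [h1]
    simp only [smul_apply, mul_apply_eq_comp, norm_smul,
      Complex.norm_real, Real.norm_eq_abs, abs_of_nonneg (sub_nonneg.2 hf)]
    exact mul_le_mul_of_nonneg_left h2 (sub_nonneg.2 hf)
  · have h1 : P - Z = P * (P - Z) := by rw [mul_sub, hPP, hPZ]
    have h2 : P * (X - P) = 0 := by rw [mul_sub, hX₂, hPP, sub_self]
    have h := congr($h2 x)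
    simp only [mul_apply_eq_comp, zero_apply] at h
    rw [smul_apply, inner_smul_right, h1, mul_apply_eq_comp P,
      hP, ← Submodule.inner_starProjection_left_eq_right, ← hP, h, inner_zero_left, mul_zero]

/-- Gaps multiply: replacing the factor `X` by the projection that it approximates up to `1 - f`
costs a factor `f` in the gap. -/
theorem norm_mul_sub_le_of_right {X Y : E →L[ℂ] E} {K M : Submodule ℂ E} {f g : ℝ} (hf₀ : 0 ≤ f)
    (hf : f ≤ 1) (hX₁ : X * K.starProjection = K.starProjection)
    (hX₂ : K.starProjection * X = K.starProjection) (hMK : M ≤ K)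
    (hX : ‖X - K.starProjection‖ ≤ 1 - f) (hY : ‖Y‖ ≤ 1)
    (hYM : Y * M.starProjection = M.starProjection)
    (hYK : ‖Y * K.starProjection - M.starProjection‖ ≤ 1 - g) :
    ‖Y * X - M.starProjection‖ ≤ 1 - f * g := by
  have e : Y * X - M.starProjection = (f : ℂ) • (Y * K.starProjection - M.starProjection) +
      Y * (X - (f : ℂ) • K.starProjection - ((1 - f : ℝ) : ℂ) • M.starProjection) := by
    rw [mul_sub, mul_sub, mul_smul_comm, mul_smul_comm, hYM]
    push_cast
    module
  have h := norm_sub_smul_sub_smul_le hf hX₁ hX₂ hMK hX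
  rw [e]
  refine (norm_add_le _ _).trans ?_
  rw [norm_smul, Complex.norm_real, Real.norm_of_nonneg hf₀]
  have h2 := (norm_mul_le Y (X - (f : ℂ) • K.starProjection -
    ((1 - f : ℝ) : ℂ) • M.starProjection)).trans
    (mul_le_mul hY h (norm_nonneg _) zero_le_one)
  nlinarith [mul_le_mul_of_nonneg_left hYK hf₀]

/-- The mirror image of `norm_mul_sub_le_of_right`. -/
theorem norm_mul_sub_le_of_left {X Y : E →L[ℂ] E} {K M : Submodule ℂ E} {f g : ℝ} (hf₀ : 0 ≤ f)
    (hf : f ≤ 1) (hX₁ : X * K.starProjection = K.starProjection)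
    (hX₂ : K.starProjection * X = K.starProjection) (hMK : M ≤ K)
    (hX : ‖X - K.starProjection‖ ≤ 1 - f) (hY : ‖Y‖ ≤ 1)
    (hYM : M.starProjection * Y = M.starProjection)
    (hYK : ‖K.starProjection * Y - M.starProjection‖ ≤ 1 - g) :
    ‖X * Y - M.starProjection‖ ≤ 1 - f * g := by
  have e : X * Y - M.starProjection = (f : ℂ) • (K.starProjection * Y - M.starProjection) +
      (X - (f : ℂ) • K.starProjection - ((1 - f : ℝ) : ℂ) • M.starProjection) * Y := by
    rw [sub_mul, sub_mul, smul_mul_assoc, smul_mul_assoc, hYM]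
    push_cast
    module
  have h := norm_sub_smul_sub_smul_le hf hX₁ hX₂ hMK hX
  rw [e]
  refine (norm_add_le _ _).trans ?_
  rw [norm_smul, Complex.norm_real, Real.norm_of_nonneg hf₀]
  have h2 := (norm_mul_le (X - (f : ℂ) • K.starProjection -
    ((1 - f : ℝ) : ℂ) • M.starProjection) Y).trans
    (mul_le_mul h hY (norm_nonneg _) (by linarith))
  nlinarith [mul_le_mul_of_nonneg_left hYK hf₀]

end Hilbert

/-! ### Pairs of involutions of a finite set -/

section Involutions

variable {V : Type*}

/-- The orbits of the group generated by two involutions, as an equivalence relation. -/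
def link (α β : V → V) : Setoid V := Relation.EqvGen.setoid fun x y => α x = y ∨ β x = y

theorem link_left (α β : V → V) (x : V) : link α β x (α x) := Relation.EqvGen.rel _ _ (Or.inl rfl)

theorem link_right (α β : V → V) (x : V) : link α β x (β x) := Relation.EqvGen.rel _ _ (Or.inr rfl)

theorem link_le {α β : V → V} {s : Setoid V} (hα : ∀ x, s x (α x)) (hβ : ∀ x, s x (β x)) :
    link α β ≤ s :=
  Setoid.eqvGen_le fun x y h => by
    rcases h with rfl | rfl
    exacts [hα x, hβ x]

theorem link_comm (α β : V → V) : link α β = link β α :=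
  le_antisymm (link_le (link_right _ _) (link_left _ _)) (link_le (link_right _ _) (link_left _ _))

theorem even_card_of_involution {α : V → V} {S : Finset V}
    (hα : Function.Involutive α) (hS : ∀ x ∈ S, α x ∈ S) (hfix : ∀ x ∈ S, α x ≠ x) :
    Even S.card := by
  have h : ∑ _x ∈ S, (1 : ZMod 2) = 0 :=
    Finset.sum_involution (fun x _ => α x) (fun _ _ => by decide) (fun x hx _ => hfix x hx)
      (fun x hx => hS x hx) (fun x _ => hα x)
  rw [Finset.sum_const, nsmul_eq_mul, mul_one] at h
  exact (ZMod.natCast_eq_zero_iff_even).1 h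

/-- The walk `x, a x, b (a x), a (b (a x)), …`. -/
def alternatingWalk (a b : V → V) (x : V) : ℕ → V
  | 0 => x
  | n + 1 => if Even n then a (alternatingWalk a b x n) else b (alternatingWalk a b x n)

theorem alternatingWalk_prepend {a b : V → V} (hb : Function.Involutive b) (x : V) (n : ℕ) :
    alternatingWalk b a (b x) (n + 1) = alternatingWalk a b x n := by
  induction n with
  | zero => simp [alternatingWalk, hb x]
  | succ n ih =>
    rw [alternatingWalk, ih]
    by_cases h : Even n
    · simp [alternatingWalk, Nat.even_add_one, h]
    · simp [alternatingWalk, Nat.even_add_one, h]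

/-- Every orbit of two involutions is traversed by a path that uses them alternately: a longest
alternating path cannot be left at its ends. -/
theorem exists_alternating_path [Finite V] {α β : V → V} (hα : Function.Involutive α)
    (hβ : Function.Involutive β) (x₀ : V) :
    ∃ (a b : V → V) (m : ℕ) (e : Fin m → V), ((a = α ∧ b = β) ∨ (a = β ∧ b = α)) ∧
      Function.Injective e ∧ (∀ z, link α β x₀ z ↔ z ∈ Set.range e) ∧
      ∀ (i : ℕ) (h : i + 1 < m), e ⟨i + 1, h⟩ =
        if Even i then a (e ⟨i, by omega⟩) else b (e ⟨i, by omega⟩) := by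
  classical
  have : Fintype V := Fintype.ofFinite V
  let T : Set ℕ := {k | ∃ (a b : V → V) (x : V), ((a = α ∧ b = β) ∨ (a = β ∧ b = α)) ∧
    link α β x₀ x ∧ Set.InjOn (alternatingWalk a b x) (Set.Iio k)}
  have hT0 : 1 ∈ T := by
    refine ⟨α, β, x₀, Or.inl ⟨rfl, rfl⟩, (link α β).refl' x₀, ?_⟩
    intro i hi j hj _
    simp only [Set.mem_Iio] at hi hj
    omega
  have hTb : BddAbove T := by
    refine ⟨Fintype.card V, ?_⟩
    rintro k ⟨a, b, x, -, -, h⟩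
    have := Finset.card_le_univ ((Finset.range k).image (alternatingWalk a b x))
    rwa [Finset.card_image_of_injOn (by simpa using h), Finset.card_range] at this
  obtain ⟨a, b, x, hab, hx, hinj⟩ := Nat.sSup_mem ⟨1, hT0⟩ hTb
  set k := sSup T with hk
  have hmax : ∀ j ∈ T, j ≤ k := fun j hj => le_csSup hTb hj
  have hk1 : 1 ≤ k := hmax 1 hT0
  have ha : Function.Involutive a := by rcases hab with ⟨rfl, rfl⟩ | ⟨rfl, rfl⟩ <;> assumption
  have hb : Function.Involutive b := by rcases hab with ⟨rfl, rfl⟩ | ⟨rfl, rfl⟩ <;> assumption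
  have hlink : link α β = link a b := by
    rcases hab with ⟨rfl, rfl⟩ | ⟨rfl, rfl⟩
    exacts [rfl, link_comm _ _]
  have hab' : (b = α ∧ a = β) ∨ (b = β ∧ a = α) := by tauto
  set w := alternatingWalk a b x with hw
  have hsucc : ∀ n, w (n + 1) = if Even n then a (w n) else b (w n) := fun n => rfl
  let S : Set V := w '' Set.Iio k
  have hend : w k ∈ S := by
    by_contra hc
    have : k + 1 ∈ T := by
      refine ⟨a, b, x, hab, hx, ?_⟩
      intro i hi j hj hij
      rcases Nat.lt_succ_iff_lt_or_eq.1 hi with hi | rfl <;>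
        rcases Nat.lt_succ_iff_lt_or_eq.1 hj with hj | hj
      · exact hinj hi hj hij
      · exact absurd ⟨i, hi, hj ▸ hij⟩ hc
      · exact absurd ⟨j, hj, hij.symm⟩ hc
      · exact hj.symm
    have := hmax _ this
    omega
  have hstart : b x ∈ S := by
    by_contra hc
    have : k + 1 ∈ T := by
      refine ⟨b, a, b x, hab', ?_, ?_⟩
      · rw [hlink] at hx ⊢
        exact (link a b).trans' hx (link_right a b x)
      · rintro (_ | i) hi (_ | j) hj hij
        · rfl
        · rw [alternatingWalk_prepend hb] at hij
          exact absurd ⟨j, by simpa using hj, hij.symm⟩ hc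
        · rw [alternatingWalk_prepend hb] at hij
          exact absurd ⟨i, by simpa using hi, hij⟩ hc
        · rw [alternatingWalk_prepend hb, alternatingWalk_prepend hb] at hij
          rw [hinj (by simpa using hi) (by simpa using hj) hij]
    have := hmax _ this
    omega
  have hfwd : ∀ i < k, w (i + 1) ∈ S := by
    intro i hi
    rcases Nat.lt_or_ge (i + 1) k with h | h
    · exact ⟨i + 1, h, rfl⟩
    · rwa [show i + 1 = k by omega]
  have hclosed : ∀ z ∈ S, a z ∈ S ∧ b z ∈ S := by
    rintro _ ⟨i, hi, rfl⟩
    have h1 := hfwd i hi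
    rw [hsucc] at h1
    rcases i with _ | j
    · exact ⟨by simpa using h1, hstart⟩
    · have h2 : w j ∈ S := ⟨j, by simp only [Set.mem_Iio] at hi ⊢; omega, rfl⟩
      have h3 := hsucc j
      by_cases hj : Even j
      · rw [if_neg (by simpa [Nat.even_add_one] using hj)] at h1
        rw [if_pos hj] at h3
        exact ⟨by rwa [h3, ha], h1⟩
      · rw [if_pos (by simpa [Nat.even_add_one] using hj)] at h1
        rw [if_neg hj] at h3
        exact ⟨h1, by rwa [h3, hb]⟩
  have hreach : ∀ n, link α β x (w n) := by
    intro n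
    induction n with
    | zero => exact (link α β).refl' x
    | succ n ih =>
      refine (link α β).trans' ih ?_
      rw [hsucc, hlink]
      split_ifs
      exacts [link_left _ _ _, link_right _ _ _]
  let s : Setoid V := Setoid.comap (· ∈ S) ⊥
  have hs : link α β ≤ s := by
    rw [hlink]
    refine link_le (fun z => ?_) (fun z => ?_)
    · exact propext ⟨fun h => (hclosed z h).1, fun h => by simpa [ha z] using (hclosed _ h).1⟩
    · exact propext ⟨fun h => (hclosed z h).2, fun h => by simpa [hb z] using (hclosed _ h).2⟩
  refine ⟨a, b, k, fun i => w i, hab, ?_, ?_, ?_⟩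
  · intro i j hij
    exact Fin.ext (hinj i.2 j.2 hij)
  · intro z
    constructor
    · intro hz
      have h1 : link α β x z := (link α β).trans' ((link α β).symm' hx) hz
      have h2 : (x ∈ S) = (z ∈ S) := hs h1
      have h3 : x ∈ S := ⟨0, by simp only [Set.mem_Iio]; omega, rfl⟩
      obtain ⟨i, hi, rfl⟩ := h2 ▸ h3
      exact ⟨⟨i, hi⟩, rfl⟩
    · rintro ⟨i, rfl⟩
      exact (link α β).trans' hx (hreach i)
  · intro i h
    exact hsucc i

end Involutions

/-! ### Merging orbits by exchanging partners -/

section Exchange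

open Classical in
/-- The fixed points of `α` in the `s`-class of `x`. -/
noncomputable def fixedIn {V : Type*} [Fintype V] (s : Setoid V) (α : V → V) (x : V) : Finset V :=
  Finset.univ.filter fun z => s x z ∧ α z = z

variable {V : Type*} [Fintype V]

theorem mem_fixedIn {s : Setoid V} {α : V → V} {x z : V} :
    z ∈ fixedIn s α x ↔ s x z ∧ α z = z := by
  simp [fixedIn]

open Classical in
theorem even_card_fixedIn_iff {s : Setoid V} {α : V → V} (hα : Function.Involutive α)
    (hs : ∀ z, s z (α z)) (x : V) :
    Even (fixedIn s α x).card ↔ Even (fixedIn s id x).card := by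
  have h1 : fixedIn s α x = (fixedIn s id x).filter fun z => α z = z := by
    ext z
    simp [mem_fixedIn]
  have h2 := Finset.card_filter_add_card_filter_not (s := fixedIn s id x) (fun z => α z = z)
  have h3 : Even ((fixedIn s id x).filter fun z => ¬ α z = z).card := by
    refine even_card_of_involution hα (fun z hz => ?_) (fun z hz => (Finset.mem_filter.1 hz).2)
    simp only [Finset.mem_filter, mem_fixedIn, id, and_true] at hz ⊢
    exact ⟨s.trans' hz.1 (hs z), fun h => hz.2 (hα.injective h)⟩
  rw [← h2, h1, Nat.even_add]
  simp [h3]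

/-- Re-pairing along `x` and `y`: if the orbit of `x` is a cycle, then exchanging the pairs
`{x, β x}`, `{y, β y}` for `{x, y}`, `{β x, β y}` joins the orbits of `x` and `y`. The cycle does
not fall apart when its edge `{x, β x}` is removed, by the handshake lemma. -/
theorem exists_link_lt {α β : V → V} {q C : Setoid V} (hα : Function.Involutive α)
    (hβ : Function.Involutive β) (hβq : ∀ z, q z (β z)) (hqC : q ≤ C) {x y : V} (hxy : q x y)
    (hJ : ¬ link α β x y) (hfix : ∀ z, link α β x z → α z ≠ z ∧ β z ≠ z) :
    ∃ β' : V → V, Function.Involutive β' ∧ (∀ z, q z (β' z)) ∧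
      (∀ z, (fixedIn C β' z).card = (fixedIn C β z).card) ∧ link α β < link α β' := by
  classical
  have hβx : β x ≠ x := (hfix x ((link α β).refl' x)).2
  have hx : link α β x (β x) := link_right _ _ _
  have hne : x ≠ y := by rintro rfl; exact hJ ((link α β).refl' x)
  have hne2 : β x ≠ y := by rintro rfl; exact hJ hx
  have hne3 : β y ≠ x := by
    rintro h
    exact hne2 (by rw [← h, hβ])
  have hne4 : β y ≠ β x := fun h => hne (hβ.injective h).symm
  set τ : Equiv.Perm V := Equiv.swap (β x) y with hτ
  have hττ : ∀ z, τ (τ z) = z := fun z => Equiv.swap_apply_self _ _ _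
  have hτq : ∀ z, q z (τ z) := by
    intro z
    have h0 : q (β x) y := q.trans' (q.symm' (hβq x)) hxy
    by_cases h1 : z = β x
    · rw [h1, hτ, Equiv.swap_apply_left]; exact h0
    · by_cases h2 : z = y
      · rw [h2, hτ, Equiv.swap_apply_right]; exact q.symm' h0
      · rw [hτ, Equiv.swap_apply_of_ne_of_ne h1 h2]
  set β' : V → V := fun z => τ (β (τ z)) with hβ'
  have hinv : Function.Involutive β' := fun z => by simp only [hβ', hττ, hβ _]
  have hx' : β' x = y := by
    simp only [hβ', hτ]
    rw [Equiv.swap_apply_of_ne_of_ne hβx.symm hne, Equiv.swap_apply_left]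
  have hz' : ∀ z, z ≠ x → z ≠ β x → z ≠ y → z ≠ β y → β' z = β z := by
    intro z h1 h2 h3 h4
    simp only [hβ', hτ]
    rw [Equiv.swap_apply_of_ne_of_ne h2 h3, Equiv.swap_apply_of_ne_of_ne]
    · exact fun h => h1 (hβ.injective h)
    · rintro h; exact h4 (by rw [← h, hβ])
  have hxy' : link α β' x y := by
    rw [← hx']
    exact link_right _ _ _
  have hcut : link α β' x (β x) := by
    by_contra hc
    let S : Finset V := Finset.univ.filter fun z => link α β x z ∧ link α β' x z
    have hS : ∀ z, z ∈ S ↔ link α β x z ∧ link α β' x z := fun z => by simp [S]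
    have hSx : x ∈ S := (hS x).2 ⟨(link α β).refl' x, (link α β').refl' x⟩
    have h1 : Even S.card := by
      refine even_card_of_involution hα (fun z hz => ?_) (fun z hz => (hfix z ((hS z).1 hz).1).1)
      rw [hS] at hz ⊢
      exact ⟨(link α β).trans' hz.1 (link_left _ _ _), (link α β').trans' hz.2 (link_left _ _ _)⟩
    have h2 : Even (S.erase x).card := by
      refine even_card_of_involution hβ (fun z hz => ?_)
        (fun z hz => (hfix z ((hS z).1 (Finset.mem_of_mem_erase hz)).1).2)
      rw [Finset.mem_erase, hS] at hz ⊢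
      have h3 : z ≠ β x := fun h => hc (h ▸ hz.2.2)
      have h4 : z ≠ y := fun h => hJ (h ▸ hz.2.1)
      have h5 : z ≠ β y := fun h => hJ ((link α β).trans' (h ▸ hz.2.1)
        ((link α β).symm' (link_right _ _ _)))
      refine ⟨fun h => h3 (by rw [← h, hβ]), (link α β).trans' hz.2.1 (link_right _ _ _), ?_⟩
      rw [← hz' z hz.1 h3 h4 h5]
      exact (link α β').trans' hz.2.2 (link_right _ _ _)
    rw [Finset.card_erase_of_mem hSx] at h2
    have := Finset.card_pos.2 ⟨x, hSx⟩
    grind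
  have hcut' : link α β' y (β y) := by
    by_cases h : β y = y
    · rw [h]
    · have h2 : β' (β x) = β y := by
        simp only [hβ', hτ, Equiv.swap_apply_left]
        rw [Equiv.swap_apply_of_ne_of_ne hne4 h]
      refine (link α β').trans' ((link α β').trans' ((link α β').symm' hxy') hcut) ?_
      rw [← h2]
      exact link_right _ _ _
  refine ⟨β', hinv, fun z => q.trans' (q.trans' (hτq z) (hβq _)) (hτq _), fun z => ?_, ?_⟩
  · refine Finset.card_bij' (fun u _ => τ u) (fun u _ => τ u) ?_ ?_ (fun u _ => hττ u)
      (fun u _ => hττ u)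
    · intro u hu
      rw [mem_fixedIn] at hu ⊢
      refine ⟨C.trans' hu.1 (hqC (hτq u)), ?_⟩
      have := congrArg τ hu.2
      rwa [hττ] at this
    · intro u hu
      rw [mem_fixedIn] at hu ⊢
      refine ⟨C.trans' hu.1 (hqC (hτq u)), ?_⟩
      simp only [hβ', hττ, hu.2]
  · refine lt_of_le_of_ne (link_le (link_left _ _) fun z => ?_) fun h => hJ (h ▸ hxy')
    by_cases h1 : z = x
    · rw [h1]; exact hcut
    by_cases h2 : z = β x
    · rw [h2, hβ]; exact (link α β').symm' hcut
    by_cases h3 : z = y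
    · rw [h3]; exact hcut'
    by_cases h4 : z = β y
    · rw [h4, hβ]; exact (link α β').symm' hcut'
    rw [← hz' z h1 h2 h3 h4]
    exact link_right _ _ _

/-- If in a class of `C` the involutions `α`, `β` have at most three fixed points together, then
of two different orbits in that class one is a cycle: an orbit that is not has an even number of
fixed points, at least two. -/
theorem forall_ne_or_forall_ne {α β : V → V} {C : Setoid V} (hα : Function.Involutive α)
    (hβ : Function.Involutive β) (hJC : link α β ≤ C)
    (hC : ∀ x, (fixedIn C α x).card + (fixedIn C β x).card ≤ 3) {x y : V} (hxy : C x y)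
    (hJ : ¬ link α β x y) :
    (∀ z, link α β x z → α z ≠ z ∧ β z ≠ z) ∨ (∀ z, link α β y z → α z ≠ z ∧ β z ≠ z) := by
  classical
  have key : ∀ x z, link α β x z → ¬ (α z ≠ z ∧ β z ≠ z) →
      2 ≤ (fixedIn (link α β) α x).card + (fixedIn (link α β) β x).card := by
    intro x z hz h
    have h1 := even_card_fixedIn_iff hα (link_left α β) x
    have h2 := even_card_fixedIn_iff hβ (link_right α β) x
    have h3 : 0 < (fixedIn (link α β) α x).card + (fixedIn (link α β) β x).card := by
      by_cases h4 : α z = z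
      · have := Finset.card_pos.2 ⟨z, mem_fixedIn.2 ⟨hz, h4⟩⟩
        omega
      · have h5 : β z = z := by tauto
        have := Finset.card_pos.2 ⟨z, mem_fixedIn.2 ⟨hz, h5⟩⟩
        omega
    have h4 : Even ((fixedIn (link α β) α x).card + (fixedIn (link α β) β x).card) := by
      rw [Nat.even_add, h1, h2]
    obtain ⟨r, hr⟩ := h4
    omega
  by_contra hcon
  push Not at hcon
  obtain ⟨⟨z, hz, hz'⟩, u, hu, hu'⟩ := hcon
  have h1 := key x z hz (by tauto)
  have h2 := key y u hu (by tauto)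
  have h3 : ∀ γ : V → V, (fixedIn (link α β) γ x).card + (fixedIn (link α β) γ y).card ≤
      (fixedIn C γ x).card := by
    intro γ
    rw [← Finset.card_union_of_disjoint]
    · refine Finset.card_le_card fun w hw => ?_
      rw [Finset.mem_union, mem_fixedIn, mem_fixedIn] at hw
      rw [mem_fixedIn]
      rcases hw with hw | hw
      exacts [⟨hJC hw.1, hw.2⟩, ⟨C.trans' hxy (hJC hw.1), hw.2⟩]
    · rw [Finset.disjoint_left]
      intro w hw hw'
      rw [mem_fixedIn] at hw hw'
      exact hJ ((link α β).trans' hw.1 ((link α β).symm' hw'.1))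
  have h4 := h3 α
  have h5 := h3 β
  have h6 := hC x
  omega

/-- An Euler trail lemma. Regard the elements of `V` as edges joining their `p`-class to their
`q`-class; involutions within the classes of `p` and of `q` pair the edge ends at each vertex, and their orbits
are the resulting trails. If some choice of pairings leaves at most three edge ends unpaired in each
connected component, then there is a choice for which each component is a single trail: as long as
there are two trails in a component, one of them is closed and can be merged with another one. -/
theorem exists_link_eq_sup {p q : Setoid V} {α₀ β₀ : V → V} (hα₀ : Function.Involutive α₀)
    (hβ₀ : Function.Involutive β₀) (hαp : ∀ x, p x (α₀ x)) (hβq : ∀ x, q x (β₀ x))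
    (hC : ∀ x, (fixedIn (p ⊔ q) α₀ x).card + (fixedIn (p ⊔ q) β₀ x).card ≤ 3) :
    ∃ α β : V → V, Function.Involutive α ∧ Function.Involutive β ∧ (∀ x, p x (α x)) ∧
      (∀ x, q x (β x)) ∧ link α β = p ⊔ q := by
  classical
  let T : Set ((V → V) × (V → V)) := {g | Function.Involutive g.1 ∧ Function.Involutive g.2 ∧
    (∀ x, p x (g.1 x)) ∧ (∀ x, q x (g.2 x)) ∧
    ∀ x, (fixedIn (p ⊔ q) g.1 x).card + (fixedIn (p ⊔ q) g.2 x).card ≤ 3}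
  obtain ⟨⟨α, β⟩, ⟨hα, hβ, hp, hq, hfix⟩, hmax⟩ :=
    Set.Finite.exists_maximalFor (fun g : (V → V) × (V → V) => link g.1 g.2) T (Set.toFinite _)
      ⟨(α₀, β₀), hα₀, hβ₀, hαp, hβq, hC⟩
  simp only at hα hβ hp hq hfix hmax
  have hJC : link α β ≤ p ⊔ q :=
    link_le (fun x => (le_sup_left : p ≤ p ⊔ q) (hp x)) fun x => (le_sup_right : q ≤ p ⊔ q) (hq x)
  refine ⟨α, β, hα, hβ, hp, hq, le_antisymm hJC (sup_le ?_ ?_)⟩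
  · have key : ∀ x y, p x y → ¬ link α β x y →
        ¬ ∀ z, link α β x z → α z ≠ z ∧ β z ≠ z := by
      intro x y hxy hJ h
      rw [link_comm] at hJ
      obtain ⟨α', h1, h2, h3, h4⟩ := exists_link_lt hβ hα hp (le_sup_left : p ≤ p ⊔ q) hxy hJ
        (fun z hz => (h z (by rwa [link_comm])).symm)
      refine absurd (hmax (j := (α', β)) ⟨h1, hβ, h2, hq, fun x => ?_⟩ ?_) ?_
      · rw [h3]; exact hfix x
      · change link α β ≤ link α' β
        rw [link_comm α β, link_comm α' β]
        exact h4.le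
      · change ¬ link α' β ≤ link α β
        rw [link_comm α β, link_comm α' β]
        exact not_le_of_gt h4
    intro x y hxy
    by_contra hJ
    rcases forall_ne_or_forall_ne hα hβ hJC hfix ((le_sup_left : p ≤ p ⊔ q) hxy) hJ with h | h
    · exact key x y hxy hJ h
    · exact key y x (p.symm' hxy) (fun h' => hJ ((link α β).symm' h')) h
  · have key : ∀ x y, q x y → ¬ link α β x y →
        ¬ ∀ z, link α β x z → α z ≠ z ∧ β z ≠ z := by
      intro x y hxy hJ h
      obtain ⟨β', h1, h2, h3, h4⟩ := exists_link_lt hα hβ hq (le_sup_right : q ≤ p ⊔ q) hxy hJ h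
      refine absurd (hmax (j := (α, β')) ⟨hα, h1, hp, h2, fun x => ?_⟩ h4.le) (not_le_of_gt h4)
      rw [h3]; exact hfix x
    intro x y hxy
    by_contra hJ
    rcases forall_ne_or_forall_ne hα hβ hJC hfix ((le_sup_right : q ≤ p ⊔ q) hxy) hJ with h | h
    · exact key x y hxy hJ h
    · exact key y x (q.symm' hxy) (fun h' => hJ ((link α β).symm' h')) h

end Exchange

/-! ### Joins modulo two and successive pairings -/

section Parity

variable {V : Type*}

/-- An involution within the classes of `r` extends, on its fixed points, to one with at most one
fixed point in each class. -/
theorem exists_involution_extension [Finite V] {β : V → V} {r : Setoid V}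
    (hβ : Function.Involutive β) (hr : ∀ x, r x (β x)) :
    ∃ β' : V → V, Function.Involutive β' ∧ (∀ x, r x (β' x)) ∧ (∀ z, β z ≠ z → β' z = β z) ∧
      ∀ x y, β' x = x → β' y = y → r x y → x = y := by
  classical
  have : Fintype V := Fintype.ofFinite V
  let T : Set (V → V) := {g | Function.Involutive g ∧ (∀ x, r x (g x)) ∧
    ∀ z, β z ≠ z → g z = β z}
  obtain ⟨g, ⟨hg, hgr, hgβ⟩, hmin⟩ := Set.Finite.exists_minimalFor
    (fun g : V → V => (Finset.univ.filter fun z => g z = z).card) T (Set.toFinite _)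
    ⟨β, hβ, hr, fun _ _ => rfl⟩
  refine ⟨g, hg, hgr, hgβ, fun x y hx hy hxy => ?_⟩
  by_contra hne
  let g' : V → V := fun z => if z = x then y else if z = y then x else g z
  have h1 : g' ∈ T := by
    refine ⟨fun z => ?_, fun z => ?_, fun z hz => ?_⟩
    · have e1 := hg z
      simp only [g']
      grind
    · simp only [g']
      split_ifs with h1 h2
      · rw [h1]; exact hxy
      · rw [h2]; exact r.symm' hxy
      · exact hgr z
    · have e1 := hgβ z hz
      simp only [g']
      grind
  have h2 : (Finset.univ.filter fun z => g' z = z) ⊂ Finset.univ.filter fun z => g z = z := by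
    rw [Finset.ssubset_iff_of_subset]
    · exact ⟨x, by simp [hx], by simp [g', Ne.symm hne]⟩
    · intro z
      simp only [Finset.mem_filter, Finset.mem_univ, true_and, g']
      grind
  exact absurd (hmin h1 (Finset.card_le_card h2.le)) (not_le_of_gt (Finset.card_lt_card h2))

/-- A predicate preserved by `q` and by an involution is constant on the classes they generate. -/
theorem of_sup_rel {γ : V → V} {q : Setoid V} (hγ : Function.Involutive γ) {T : V → Prop}
    (hq : ∀ z z', q z z' → T z → T z') (hT : ∀ z, T z → T (γ z)) {u z : V}
    (h : (link γ id ⊔ q) u z) (hu : T u) : T z := by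
  let s : Setoid V := Setoid.comap T ⊥
  have hs : link γ id ⊔ q ≤ s := by
    refine sup_le (link_le (fun x => ?_) fun x => s.refl' x) fun x y hxy => ?_
    · exact propext ⟨hT x, fun h => by simpa [hγ x] using hT _ h⟩
    · exact propext ⟨hq x y hxy, hq y x (q.symm' hxy)⟩
  have h2 : T u = T z := hs h
  exact h2 ▸ hu

variable [Fintype V]

open Classical in
theorem sum_class_single (q : Setoid V) (x u : V) :
    ∑ z ∈ fixedIn q id x, (if z = u then (1 : ZMod 2) else 0) = if q x u then 1 else 0 := by
  rw [Finset.sum_ite_eq']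
  simp [mem_fixedIn]

open Classical in
/-- The edges of a connected graph span all even boundaries modulo two. Here the vertices are the
`q`-classes and the edges the pairs of `α`. -/
theorem exists_boundary_eq {α : V → V} (hα : Function.Involutive α) (q : Setoid V) {u v : V}
    (huv : (link α id ⊔ q) u v) :
    ∃ h : V → ZMod 2, (∀ x, h (α x) = h x) ∧ (∀ z, α z = z → h z = 0) ∧
      ∀ x, ∑ z ∈ fixedIn q id x, h z = (if q x u then 1 else 0) + if q x v then 1 else 0 := by
  let R : V → V → Prop := fun u v => ∃ h : V → ZMod 2, (∀ x, h (α x) = h x) ∧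
    (∀ z, α z = z → h z = 0) ∧
      ∀ x, ∑ z ∈ fixedIn q id x, h z = (if q x u then 1 else 0) + if q x v then 1 else 0
  have hrefl : ∀ u v, q u v → R u v := by
    intro u v huv
    refine ⟨0, fun _ => rfl, fun _ _ => rfl, fun x => ?_⟩
    have : q x u ↔ q x v := ⟨fun h => q.trans' h huv, fun h => q.trans' h (q.symm' huv)⟩
    simp [this, CharTwo.add_self_eq_zero]
  let s : Setoid V := ⟨R, fun u => hrefl u u (q.refl' u), fun ⟨h, h1, h2, h3⟩ =>
    ⟨h, h1, h2, fun x => by rw [h3, add_comm]⟩, fun {u v w} ⟨h, h1, h2, h3⟩ ⟨g, g1, g2, g3⟩ =>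
      ⟨h + g, fun x => by simp [h1, g1], fun z hz => by simp [h2 z hz, g2 z hz], fun x => by
        simp only [Pi.add_apply, Finset.sum_add_distrib, h3, g3]
        have := CharTwo.add_self_eq_zero (if q x v then (1 : ZMod 2) else 0)
        linear_combination this⟩⟩
  have hs : link α id ⊔ q ≤ s := by
    refine sup_le (link_le (fun x => ?_) fun x => s.refl' x) fun x y hxy => hrefl x y hxy
    by_cases hx : α x = x
    · rw [hx]
    · refine ⟨fun z => (if z = x then 1 else 0) + if z = α x then 1 else 0, fun z => ?_,
        fun z hz => ?_, fun y => ?_⟩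
      · have h1 : α z = x ↔ z = α x := ⟨fun h => by rw [← h, hα], fun h => by rw [h, hα]⟩
        have h2 : α z = α x ↔ z = x := hα.injective.eq_iff
        simp only [h1, h2]
        exact add_comm _ _
      · have h1 : z ≠ x := by rintro rfl; exact hx hz
        have h2 : z ≠ α x := by rintro rfl; exact hx (by rw [hα] at hz; exact hz.symm)
        simp [h1, h2]
      · rw [Finset.sum_add_distrib, sum_class_single, sum_class_single]
  exact hs huv

/-- A `T`-join: a set `k = 1` of pairs and of fixed points of `α` that meets every `q`-class evenly
and contains all fixed points except at most one in each connected component. -/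
theorem exists_join {α : V → V} (hα : Function.Involutive α) (q : Setoid V) :
    ∃ k : V → ZMod 2, (∀ x, k (α x) = k x) ∧ (∀ x, ∑ z ∈ fixedIn q id x, k z = 0) ∧
      ∀ x y, α x = x → α y = y → k x = 0 → k y = 0 → (link α id ⊔ q) x y → x = y := by
  classical
  let T : Set (V → ZMod 2) := {k | (∀ x, k (α x) = k x) ∧ ∀ x, ∑ z ∈ fixedIn q id x, k z = 0}
  obtain ⟨k, ⟨hk, hq⟩, hmin⟩ := Set.Finite.exists_minimalFor
    (fun k : V → ZMod 2 => (Finset.univ.filter fun z => α z = z ∧ k z = 0).card) T (Set.toFinite _)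
    ⟨0, fun _ => rfl, fun _ => by simp⟩
  refine ⟨k, hk, hq, fun u v hu hv hku hkv huv => ?_⟩
  by_contra hne
  obtain ⟨h, h1, h2, h3⟩ := exists_boundary_eq hα q huv
  let k' : V → ZMod 2 := fun z => k z + h z + (if z = u then 1 else 0) + if z = v then 1 else 0
  have hu' : ∀ z, α z = u ↔ z = u := fun z => by
    constructor <;> intro h
    · rw [← hα z, h, hu]
    · rw [h, hu]
  have hv' : ∀ z, α z = v ↔ z = v := fun z => by
    constructor <;> intro h
    · rw [← hα z, h, hv]
    · rw [h, hv]
  have hk' : k' ∈ T := by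
    refine ⟨fun x => by simp only [k', hk, h1, hu', hv'], fun x => ?_⟩
    simp only [k', Finset.sum_add_distrib, sum_class_single, hq, h3]
    have e1 := CharTwo.add_self_eq_zero (if q x u then (1 : ZMod 2) else 0)
    have e2 := CharTwo.add_self_eq_zero (if q x v then (1 : ZMod 2) else 0)
    linear_combination e1 + e2
  have hlt : (Finset.univ.filter fun z => α z = z ∧ k' z = 0) ⊂
      Finset.univ.filter fun z => α z = z ∧ k z = 0 := by
    rw [Finset.ssubset_iff_of_subset]
    · refine ⟨u, by simp [hu, hku], ?_⟩
      simp [k', hku, h2 u hu, hne]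
    · intro z
      simp only [Finset.mem_filter, Finset.mem_univ, true_and]
      rintro ⟨hz, hz'⟩
      refine ⟨hz, ?_⟩
      by_cases hzu : z = u
      · rw [hzu, hku]
      by_cases hzv : z = v
      · rw [hzv, hkv]
      simpa [k', h2 z hz, hzu, hzv] using hz'
  exact absurd (hmin hk' (Finset.card_le_card hlt.le)) (not_le_of_gt (Finset.card_lt_card hlt))

/-- If `z` is the only fixed point of an involution in its class, then the class is odd. -/
theorem not_even_card_class {s : Setoid V} {α : V → V} (hα : Function.Involutive α)
    (hs : ∀ x, s x (α x)) {z : V} (hz : α z = z) (huniq : ∀ y, α y = y → s z y → z = y) :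
    ¬ Even (fixedIn s id z).card := by
  rw [← even_card_fixedIn_iff hα hs]
  have : fixedIn s α z = {z} := by
    ext y
    rw [mem_fixedIn, Finset.mem_singleton]
    refine ⟨fun h => (huniq y h.2 h.1).symm, ?_⟩
    rintro rfl
    exact ⟨s.refl' y, hz⟩
  rw [this]
  simp

/-- The pairings that merge a matching `α` with an arbitrary partition `q` in three rounds.
The pairs of `α` and the involution `β ≤ q` form trails, which are grouped by a `T`-join such that
in each component of the whole graph all trails but one have an even number of elements. Then
`γ` pairs the elements left over by `β` along the trails, joining the odd `q`-classes in twos.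
Afterwards at most one trail in each component is odd, so that `γ` itself and a pairing `α'` along
the trails leave out at most one element of it. -/
theorem exists_three_pairings {α : V → V} (hα : Function.Involutive α) (q : Setoid V) :
    ∃ β γ α' : V → V, Function.Involutive β ∧ Function.Involutive γ ∧ Function.Involutive α' ∧
      (∀ x, q x (β x)) ∧ (∀ x, link α β x (γ x)) ∧ (∀ x, link α β x (α' x)) ∧
      (∀ x, (fixedIn (link γ id ⊔ q) γ x).card + (fixedIn (link γ id ⊔ q) β x).card ≤ 3) ∧
      ∀ x, (fixedIn (link α β ⊔ (link γ id ⊔ q)) α' x).card +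
        (fixedIn (link α β ⊔ (link γ id ⊔ q)) γ x).card ≤ 3 := by
  classical
  obtain ⟨k, hkα, hkq, hkfix⟩ := exists_join hα q
  obtain ⟨β, hβ, hβr, -, hβfix⟩ := exists_involution_extension (r := q ⊓ Setoid.ker k)
    (β := id) (fun _ => rfl) (fun x => (q ⊓ Setoid.ker k).refl' x)
  have hβq : ∀ x, q x (β x) := fun x => (hβr x).1
  have hβk : ∀ x, k (β x) = k x := fun x => ((hβr x).2 : k x = k (β x)).symm
  obtain ⟨γ, hγ, hγr, hγβ, hγfix⟩ := exists_involution_extension hβ (link_right α β)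
  obtain ⟨α', hα', hα'r, -, hα'fix⟩ := exists_involution_extension hα (link_left α β)
  have hzero : ∀ z, β z = z → k z = 0 := by
    intro z hz
    by_contra hkz
    have hone : ∀ a : ZMod 2, a ≠ 0 → a = 1 := by decide
    refine not_even_card_class (s := q ⊓ Setoid.ker k) hβ hβr hz
      (fun y hy hzy => hβfix z y hz hy hzy) ?_
    have e1 : fixedIn (q ⊓ Setoid.ker k) id z = (fixedIn q id z).filter fun y => k y ≠ 0 := by
      ext y
      simp only [mem_fixedIn, Finset.mem_filter, id, and_true]
      refine and_congr_right fun _ => ⟨fun h => ?_, fun h => ?_⟩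
      · rwa [← (h : k z = k y)]
      · exact ((hone _ hkz).trans (hone _ h).symm : k z = k y)
    have e2 := hkq z
    rw [← Finset.sum_filter_ne_zero, Finset.sum_congr rfl
      (fun y hy => hone (k y) (Finset.mem_filter.1 hy).2), Finset.sum_const, nsmul_eq_mul,
      mul_one, ZMod.natCast_eq_zero_iff_even, ← e1] at e2
    exact e2
  have huniq : ∀ x y, β x = x → β y = y → q x y → x = y := fun x y hx hy hxy =>
    hβfix x y hx hy ⟨hxy, ((hzero x hx).trans (hzero y hy).symm : k x = k y)⟩
  have hγ_of_β : ∀ z, γ z = z → β z = z := by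
    intro z hz
    by_contra h
    exact h ((hγβ z h).symm.trans hz)
  have hβγ : ∀ z, β z = z → β (γ z) = γ z := by
    intro z hz
    by_contra h
    have h1 := hγβ _ h
    rw [hγ] at h1
    have h2 : γ z = z := (hβ (γ z)).symm.trans ((congrArg β h1.symm).trans hz)
    exact h (by rw [h2, hz])
  refine ⟨β, γ, α', hβ, hγ, hα', hβq, hγr, hα'r, fun x => ?_, fun x => ?_⟩
  · rcases (fixedIn (link γ id ⊔ q) β x).eq_empty_or_nonempty with h0 | ⟨u, hu⟩
    · have h1 : fixedIn (link γ id ⊔ q) γ x = ∅ := by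
        rw [Finset.eq_empty_iff_forall_notMem] at h0 ⊢
        intro z hz
        rw [mem_fixedIn] at hz
        exact h0 z (mem_fixedIn.2 ⟨hz.1, hγ_of_β z hz.2⟩)
      simp [h0, h1]
    · rw [mem_fixedIn] at hu
      have key : ∀ z, (link γ id ⊔ q) x z → β z = z → z = u ∨ z = γ u := by
        intro z hz hzβ
        have h1 := of_sup_rel hγ (q := q) (T := fun z => q u z ∨ q (γ u) z) (u := u) (z := z)
          (fun z z' h h' => h'.imp (fun h' => q.trans' h' h) (fun h' => q.trans' h' h))
          (fun z h => ?_) ((link γ id ⊔ q).trans' ((link γ id ⊔ q).symm' hu.1) hz)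
          (Or.inl (q.refl' u))
        · rcases h1 with h1 | h1
          · exact Or.inl (huniq _ _ hu.2 hzβ h1).symm
          · exact Or.inr (huniq _ _ (hβγ u hu.2) hzβ h1).symm
        · by_cases hzz : β z = z
          · rcases h with h | h
            · rw [← huniq _ _ hu.2 hzz h]
              exact Or.inr (q.refl' _)
            · rw [← huniq _ _ (hβγ u hu.2) hzz h, hγ]
              exact Or.inl (q.refl' _)
          · rw [hγβ z hzz]
            exact h.imp (fun h => q.trans' h (hβq z)) (fun h => q.trans' h (hβq z))
      have h1 : (fixedIn (link γ id ⊔ q) β x).card ≤ 2 := by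
        refine (Finset.card_le_card (t := {u, γ u}) fun z hz => ?_).trans Finset.card_le_two
        rw [mem_fixedIn] at hz
        simpa using key z hz.1 hz.2
      have h2 : (fixedIn (link γ id ⊔ q) γ x).card ≤ 1 := by
        refine Finset.card_le_one.2 fun z hz z' hz' => ?_
        rw [mem_fixedIn] at hz hz'
        have h3 := key z hz.1 (hγ_of_β z hz.2)
        have h4 := key z' hz'.1 (hγ_of_β z' hz'.2)
        have h5 := hz.2
        have h6 := hz'.2
        have h7 := hγ u
        grind
      omega
  · have hkJ : link α β ≤ Setoid.ker k :=
      link_le (fun z => (hkα z).symm) (fun z => (hβk z).symm)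
    have hodd : ∀ z, ¬ Even (fixedIn (link α β) id z).card →
        ∃ w, link α β z w ∧ α w = w ∧ k w = 0 := by
      intro z hz
      have h1 : (fixedIn (link α β) α z).Nonempty := by
        rw [Finset.nonempty_iff_ne_empty]
        intro h
        refine hz ((even_card_fixedIn_iff hα (link_left α β) z).1 ?_)
        simp [h]
      have h2 : (fixedIn (link α β) β z).Nonempty := by
        rw [Finset.nonempty_iff_ne_empty]
        intro h
        refine hz ((even_card_fixedIn_iff hβ (link_right α β) z).1 ?_)
        simp [h]
      obtain ⟨w, hw⟩ := h1
      obtain ⟨v, hv⟩ := h2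
      rw [mem_fixedIn] at hw hv
      refine ⟨w, hw.1, hw.2, ?_⟩
      have h3 : k w = k v := hkJ ((link α β).trans' ((link α β).symm' hw.1) hv.1)
      rw [h3, hzero v hv.2]
    have hle : link α β ⊔ (link γ id ⊔ q) ≤ link α id ⊔ q := by
      have h1 : link α β ≤ link α id ⊔ q :=
        link_le (fun z => (le_sup_left : _ ≤ link α id ⊔ q) (link_left α id z))
          (fun z => (le_sup_right : _ ≤ link α id ⊔ q) (hβq z))
      exact sup_le h1 (sup_le (link_le (fun z => h1 (hγr z)) fun z => Setoid.refl' _ z)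
        le_sup_right)
    have hcard : ∀ δ : V → V, Function.Involutive δ → (∀ z, link α β z (δ z)) →
        (∀ z z', δ z = z → δ z' = z' → link α β z z' → z = z') →
        (fixedIn (link α β ⊔ (link γ id ⊔ q)) δ x).card ≤ 1 := by
      intro δ hδ hδr hδfix
      refine Finset.card_le_one.2 fun z hz z' hz' => ?_
      rw [mem_fixedIn] at hz hz'
      obtain ⟨w, hw, hwα, hwk⟩ := hodd z (not_even_card_class hδ hδr hz.2
        fun y hy hzy => hδfix z y hz.2 hy hzy)
      obtain ⟨w', hw', hwα', hwk'⟩ := hodd z' (not_even_card_class hδ hδr hz'.2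
        fun y hy hzy => hδfix z' y hz'.2 hy hzy)
      have h1 : link α β ≤ link α β ⊔ (link γ id ⊔ q) := le_sup_left
      have h2 : w = w' := hkfix w w' hwα hwα' hwk hwk' (hle (Setoid.trans' _ (Setoid.symm' _
        (Setoid.trans' _ hz.1 (h1 hw))) (Setoid.trans' _ hz'.1 (h1 hw'))))
      subst h2
      exact hδfix z z' hz.2 hz'.2 ((link α β).trans' hw ((link α β).symm' hw'))
    have h1 := hcard α' hα' hα'r hα'fix
    have h2 := hcard γ hγ hγr hγfix
    omega

end Parity

/-! ### The moment representation of the unitary group -/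

/-- The Hilbert space on which `V^{⊗t} ⊗ (V^*)^{⊗t}` acts. -/
abbrev MomentSpace (t : ℕ) (ι : Type) [Fintype ι] : Type :=
  EuclideanSpace ℂ ((Fin t → ι) × (Fin t → ι))

section Representation

variable {ι : Type} [Fintype ι] [DecidableEq ι]

theorem tensorPower_mul (t : ℕ) (V W : U ι) :
    tensorPower t (V * W) = tensorPower t V * tensorPower t W := by
  ext a b
  have h : ∀ (f g : ι → ι → ℂ) (x y : Fin t → ι), ∏ k, ∑ j, f (x k) j * g j (y k) =
      ∑ c : Fin t → ι, ∏ k, f (x k) (c k) * g (c k) (y k) := by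
    intro f g x y
    rw [Finset.prod_univ_sum, Fintype.piFinset_univ]
  rw [Matrix.mul_apply, Fintype.sum_prod_type]
  simp only [tensorPower, Matrix.of_apply, Matrix.UnitaryGroup.mul_val, Matrix.mul_apply, star_sum,
    star_mul']
  rw [h V.1 W.1, h (fun i j => star (V.1 i j)) (fun i j => star (W.1 i j)), Finset.sum_mul_sum]
  refine Finset.sum_congr rfl fun c _ => Finset.sum_congr rfl fun c' _ => ?_
  simp only [Finset.prod_mul_distrib]
  ring

theorem tensorPower_one (t : ℕ) : tensorPower t (1 : U ι) = 1 := by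
  ext a b
  have h : ∀ x y : Fin t → ι, ∏ k, (1 : Matrix ι ι ℂ) (x k) (y k) = if x = y then 1 else 0 := by
    intro x y
    simp only [Matrix.one_apply, Finset.prod_boole, funext_iff, Finset.mem_univ, true_imp_iff]
  simp only [tensorPower, Matrix.of_apply, Matrix.UnitaryGroup.one_val, ← star_prod, h]
  rw [Matrix.one_apply]
  simp only [Prod.ext_iff]
  split_ifs <;> simp_all

theorem tensorPower_inv (t : ℕ) (V : U ι) : tensorPower t V⁻¹ = star (tensorPower t V) := by
  ext a b
  simp only [tensorPower, Matrix.of_apply, Matrix.star_apply, Matrix.UnitaryGroup.inv_val,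
    star_mul', star_prod, star_star]

/-- The representation `V ↦ V^{⊗t} ⊗ (V^*)^{⊗t}`. -/
noncomputable def rho (t : ℕ) : U ι →* (MomentSpace t ι →L[ℂ] MomentSpace t ι) where
  toFun V := Matrix.toEuclideanCLM (n := (Fin t → ι) × (Fin t → ι)) (𝕜 := ℂ) (tensorPower t V)
  map_one' := by rw [tensorPower_one, map_one]
  map_mul' V W := by rw [tensorPower_mul, map_mul]

variable {t : ℕ}

theorem rho_apply (V : U ι) (x : MomentSpace t ι) (a : (Fin t → ι) × (Fin t → ι)) :
    rho t V x a = ∑ b, tensorPower t V a b * x b := rfl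

theorem adjoint_rho (V : U ι) : (rho t V).adjoint = rho t V⁻¹ := by
  rw [← ContinuousLinearMap.star_eq_adjoint]
  simp only [rho, MonoidHom.coe_mk, OneHom.coe_mk, tensorPower_inv, map_star]

theorem rho_inv_apply_self (V : U ι) (x : MomentSpace t ι) : rho t V⁻¹ (rho t V x) = x := by
  rw [← mul_apply_eq_comp, ← map_mul, inv_mul_cancel, map_one]
  rfl

theorem norm_rho_apply (V : U ι) (x : MomentSpace t ι) : ‖rho t V x‖ = ‖x‖ := by
  have h : inner ℂ (rho t V x) (rho t V x) = inner ℂ x x := by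
    rw [← ContinuousLinearMap.adjoint_inner_right, adjoint_rho, rho_inv_apply_self]
  rw [inner_self_eq_norm_sq_to_K, inner_self_eq_norm_sq_to_K] at h
  have h2 : ‖rho t V x‖ ^ 2 = ‖x‖ ^ 2 := by exact_mod_cast h
  exact (sq_eq_sq₀ (norm_nonneg _) (norm_nonneg _)).1 h2

theorem norm_rho_le (V : U ι) : ‖rho t V‖ ≤ 1 :=
  ContinuousLinearMap.opNorm_le_bound _ zero_le_one fun x => by rw [norm_rho_apply, one_mul]

/-- The vectors of the moment space fixed by a set of unitaries. -/
def invariants (t : ℕ) (S : Set (U ι)) : Submodule ℂ (MomentSpace t ι) where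
  carrier := {x | ∀ V ∈ S, rho t V x = x}
  add_mem' hx hy V hV := by rw [map_add, hx V hV, hy V hV]
  zero_mem' V _ := map_zero _
  smul_mem' c x hx V hV := by rw [map_smul, hx V hV]

theorem mem_invariants {S : Set (U ι)} {x : MomentSpace t ι} :
    x ∈ invariants t S ↔ ∀ V ∈ S, rho t V x = x := Iff.rfl

theorem invariants_anti {S T : Set (U ι)} (h : S ⊆ T) : invariants t T ≤ invariants t S :=
  fun _ hx V hV => hx V (h hV)

theorem commute_starProjection_invariants {S : Set (U ι)}
    {A : MomentSpace t ι →L[ℂ] MomentSpace t ι} (hA : ∀ V ∈ S, Commute A (rho t V)) :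
    Commute A (invariants t S).starProjection := by
  refine commute_starProjection (fun x hx V hV => ?_) (fun x hx V hV => ?_)
  · rw [← mul_apply_eq_comp, ← (hA V hV).eq, mul_apply_eq_comp, hx V hV]
  · have h1 : Commute A (rho t V⁻¹) := by
      have e : rho t V⁻¹ * rho t V = 1 := by rw [← map_mul, inv_mul_cancel, map_one]
      have e' : rho t V * rho t V⁻¹ = 1 := by rw [← map_mul, mul_inv_cancel, map_one]
      calc A * rho t V⁻¹ = rho t V⁻¹ * (rho t V * A) * rho t V⁻¹ := by
            rw [← mul_assoc, e, one_mul]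
        _ = rho t V⁻¹ * (A * rho t V) * rho t V⁻¹ := by rw [(hA V hV).eq]
        _ = rho t V⁻¹ * A := by rw [mul_assoc, mul_assoc, e', mul_one]
    have h2 : Commute A.adjoint (rho t V) := by
      have := h1.star_star
      rwa [ContinuousLinearMap.star_eq_adjoint, ContinuousLinearMap.star_eq_adjoint, adjoint_rho,
        inv_inv] at this
    rw [← mul_apply_eq_comp, ← h2.eq, mul_apply_eq_comp, hx V hV]

theorem commute_starProjection_invariants_invariants {S T : Set (U ι)}
    (h : ∀ V ∈ S, ∀ W ∈ T, Commute V W) :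
    Commute (invariants t S).starProjection (invariants t T).starProjection :=
  commute_starProjection_invariants fun W hW =>
    (commute_starProjection_invariants fun V hV => ((h V hV W hW).symm.map (rho t))).symm

end Representation

/-! ### Amplification by idle tensor factors -/

section Amplification

variable {ι κ τ : Type} [Fintype ι] [Fintype κ]

/-- `σ` copied to the `2t` tensor factors of the moment space. -/
def momentIndexEquiv (t : ℕ) (σ : κ ≃ ι × τ) : (Fin t → κ) × (Fin t → κ) ≃
    ((Fin t → ι) × (Fin t → ι)) × ((Fin t → τ) × (Fin t → τ)) where
  toFun a := ((fun k => (σ (a.1 k)).1, fun k => (σ (a.2 k)).1),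
    (fun k => (σ (a.1 k)).2, fun k => (σ (a.2 k)).2))
  invFun c := (fun k => σ.symm (c.1.1 k, c.2.1 k), fun k => σ.symm (c.1.2 k, c.2.2 k))
  left_inv a := by simp
  right_inv c := by simp

variable {t : ℕ}

/-- The component of a vector at a fixed configuration `z` of the idle tensor factors. -/
noncomputable def fiber (σ : κ ≃ ι × τ) (z : (Fin t → τ) × (Fin t → τ)) :
    MomentSpace t κ →L[ℂ] MomentSpace t ι :=
  LinearMap.toContinuousLinearMap
    { toFun := fun x => WithLp.toLp 2 fun c => x ((momentIndexEquiv t σ).symm (c, z))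
      map_add' := fun _ _ => rfl
      map_smul' := fun _ _ => rfl }

theorem fiber_apply (σ : κ ≃ ι × τ) (z : (Fin t → τ) × (Fin t → τ)) (x : MomentSpace t κ)
    (c : (Fin t → ι) × (Fin t → ι)) : fiber σ z x c = x ((momentIndexEquiv t σ).symm (c, z)) := rfl

section

variable [DecidableEq τ]

/-- The vector with component `w` at the configuration `z` of the idle factors, and no others. -/
noncomputable def fiberSingle (σ : κ ≃ ι × τ) (z : (Fin t → τ) × (Fin t → τ))
    (w : MomentSpace t ι) : MomentSpace t κ :=
  WithLp.toLp 2 fun a => if ((momentIndexEquiv t σ) a).2 = z then w ((momentIndexEquiv t σ) a).1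
    else 0

theorem fiber_fiberSingle (σ : κ ≃ ι × τ) (z z' : (Fin t → τ) × (Fin t → τ))
    (w : MomentSpace t ι) : fiber σ z' (fiberSingle σ z w) = if z' = z then w else 0 := by
  ext c
  rw [fiber_apply, fiberSingle]
  simp only [Equiv.apply_symm_apply]
  split_ifs <;> rfl

end

variable [Fintype τ]

theorem sum_momentIndex (σ : κ ≃ ι × τ) {M : Type*} [AddCommMonoid M]
    (f : (Fin t → κ) × (Fin t → κ) → M) :
    ∑ a, f a = ∑ z, ∑ c, f ((momentIndexEquiv t σ).symm (c, z)) := by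
  rw [← (momentIndexEquiv t σ).symm.sum_comp, Fintype.sum_prod_type_right]

theorem norm_sq_eq_sum_fiber (σ : κ ≃ ι × τ) (x : MomentSpace t κ) :
    ‖x‖ ^ 2 = ∑ z, ‖fiber σ z x‖ ^ 2 := by
  simp only [EuclideanSpace.norm_sq_eq, fiber_apply]
  exact sum_momentIndex σ fun a => ‖x a‖ ^ 2

theorem ext_fiber (σ : κ ≃ ι × τ) {x y : MomentSpace t κ} (h : ∀ z, fiber σ z x = fiber σ z y) :
    x = y := by
  have h1 : ‖x - y‖ ^ 2 = 0 := by
    rw [norm_sq_eq_sum_fiber σ]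
    simp [h]
  exact sub_eq_zero.1 (norm_eq_zero.1 (pow_eq_zero_iff two_ne_zero |>.1 h1))

/-- An operator of the form `B ⊗ 1` has at most the norm of `B`. -/
theorem norm_le_of_fiber {σ : κ ≃ ι × τ} {A : MomentSpace t κ →L[ℂ] MomentSpace t κ}
    {B : MomentSpace t ι →L[ℂ] MomentSpace t ι}
    (h : ∀ z x, fiber σ z (A x) = B (fiber σ z x)) : ‖A‖ ≤ ‖B‖ := by
  refine ContinuousLinearMap.opNorm_le_bound _ (norm_nonneg _) fun x => ?_
  refine le_of_sq_le_sq ?_ (by positivity)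
  rw [norm_sq_eq_sum_fiber σ, mul_pow, norm_sq_eq_sum_fiber σ, Finset.mul_sum]
  refine Finset.sum_le_sum fun z _ => ?_
  rw [h, ← mul_pow]
  exact pow_le_pow_left₀ (norm_nonneg _) (B.le_opNorm _) 2

section

variable [DecidableEq τ]

theorem inner_fiberSingle (σ : κ ≃ ι × τ) (z : (Fin t → τ) × (Fin t → τ))
    (w : MomentSpace t ι) (x : MomentSpace t κ) :
    inner ℂ (fiberSingle σ z w) x = inner ℂ w (fiber σ z x) := by
  rw [PiLp.inner_apply, PiLp.inner_apply, sum_momentIndex σ, Finset.sum_eq_single z]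
  · refine Finset.sum_congr rfl fun c _ => ?_
    simp [fiberSingle, fiber_apply]
  · intro z' _ hz
    refine Finset.sum_eq_zero fun c _ => ?_
    simp [fiberSingle, hz]
  · simp

/-- The projection onto a subspace of the form `L ⊗ ⊤` acts on each fiber as the one onto `L`. -/
theorem fiber_starProjection {σ : κ ≃ ι × τ} {K : Submodule ℂ (MomentSpace t κ)}
    {L : Submodule ℂ (MomentSpace t ι)} (h : ∀ x, x ∈ K ↔ ∀ z, fiber σ z x ∈ L)
    (z : (Fin t → τ) × (Fin t → τ)) (x : MomentSpace t κ) :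
    fiber σ z (K.starProjection x) = L.starProjection (fiber σ z x) := by
  symm
  refine Submodule.eq_starProjection_of_mem_orthogonal
    ((h _).1 (K.starProjection_apply_mem x) z) ?_
  intro w hw
  rw [← map_sub, ← inner_fiberSingle]
  refine K.sub_starProjection_mem_orthogonal x _ ((h _).2 fun z' => ?_)
  rw [fiber_fiberSingle]
  split_ifs
  exacts [hw, L.zero_mem]

end

variable [DecidableEq ι] [DecidableEq κ] [DecidableEq τ]

/-- `W = V ⊗ 1` with respect to the identification `σ` of the index set of `W` with a product. -/
def IsAmplification (σ : κ ≃ ι × τ) (V : U ι) (W : U κ) : Prop :=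
  ∀ a b, W.1 a b = if (σ a).2 = (σ b).2 then V.1 (σ a).1 (σ b).1 else 0

theorem fiber_rho {σ : κ ≃ ι × τ} {V : U ι} {W : U κ} (h : IsAmplification σ V W)
    (z : (Fin t → τ) × (Fin t → τ)) (x : MomentSpace t κ) :
    fiber σ z (rho t W x) = rho t V (fiber σ z x) := by
  ext c
  rw [fiber_apply, rho_apply, rho_apply, sum_momentIndex σ]
  have key : ∀ z' c', tensorPower t W ((momentIndexEquiv t σ).symm (c, z))
      ((momentIndexEquiv t σ).symm (c', z')) = if z = z' then tensorPower t V c c' else 0 := by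
    intro z' c'
    have h1 : ∀ (u v : Fin t → τ) (f : Fin t → ℂ), (∏ k, if u k = v k then f k else 0) =
        if u = v then ∏ k, f k else 0 := by
      intro u v f
      by_cases huv : u = v
      · simp [huv]
      · obtain ⟨k, hk⟩ := Function.ne_iff.1 huv
        rw [if_neg huv, Finset.prod_eq_zero (Finset.mem_univ k) (if_neg hk)]
    simp only [tensorPower, Matrix.of_apply, momentIndexEquiv, Equiv.coe_fn_symm_mk, h _ _,
      Equiv.apply_symm_apply, apply_ite star, star_zero, h1, Prod.ext_iff]
    split_ifs <;> simp_all
  simp only [key, ite_mul, zero_mul]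
  rw [Finset.sum_comm]
  simp only [Finset.sum_ite_eq, Finset.mem_univ, if_true]
  rfl

theorem mem_invariants_iff_fiber {σ : κ ≃ ι × τ} {S : Set (U ι)} {T : Set (U κ)}
    (h₁ : ∀ V ∈ S, ∃ W ∈ T, IsAmplification σ V W) (h₂ : ∀ W ∈ T, ∃ V ∈ S, IsAmplification σ V W)
    (x : MomentSpace t κ) : x ∈ invariants t T ↔ ∀ z, fiber σ z x ∈ invariants t S := by
  constructor
  · intro hx z V hV
    obtain ⟨W, hW, hVW⟩ := h₁ V hV
    rw [← fiber_rho hVW, hx W hW]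
  · intro hx W hW
    obtain ⟨V, hV, hVW⟩ := h₂ W hW
    refine ext_fiber σ fun z => ?_
    rw [fiber_rho hVW, hx z V hV]

end Amplification

/-! ### Two-qudit gates and the vectors they fix -/

/-- The unitary group does not depend on the names of the basis vectors. -/
def reindexUnitary {ι κ : Type} [Fintype ι] [DecidableEq ι] [Fintype κ] [DecidableEq κ]
    (e : κ ≃ ι) (V : U ι) : U κ :=
  ⟨V.1.submatrix e e, by
    have h := Matrix.mem_unitaryGroup_iff.1 V.2
    rw [Matrix.mem_unitaryGroup_iff, Matrix.star_eq_conjTranspose, Matrix.conjTranspose_submatrix,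
      Matrix.submatrix_mul_equiv, ← Matrix.star_eq_conjTranspose, h, Matrix.submatrix_one_equiv]⟩

section Gates

variable {N m d t : ℕ}

/-- The configurations of `N` sites, split into those of the sites `e i` and of all others. -/
noncomputable def siteEquiv (d : ℕ) (e : Fin m → Fin N) (he : Function.Injective e) :
    (Fin N → Fin d) ≃ (Fin m → Fin d) × ({k : Fin N // ∀ i, e i ≠ k} → Fin d) where
  toFun x := (fun i => x (e i), fun k => x k)
  invFun c k := if h : ∃ i, e i = k then c.1 h.choose else c.2 ⟨k, not_exists.1 h⟩
  left_inv x := by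
    funext k
    by_cases h : ∃ i, e i = k
    · simp only [dif_pos h, h.choose_spec]
    · simp only [dif_neg h]
  right_inv c := by
    refine Prod.ext (funext fun i => ?_) (funext fun k => ?_)
    · have h : ∃ j, e j = e i := ⟨i, rfl⟩
      simp only [dif_pos h]
      rw [he h.choose_spec]
    · have h : ¬ ∃ i, e i = k := not_exists.2 k.2
      simp only [dif_neg h]

theorem injective_pair {i j : Fin N} (hij : i ≠ j) : Function.Injective ![i, j] := by
  intro a b
  fin_cases a <;> fin_cases b <;> simp [hij, hij.symm]

/-- The configurations of `N` sites, split into those of the pair of sites `i`, `j` and of all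
others. -/
noncomputable def pairEquiv (d : ℕ) {i j : Fin N} (hij : i ≠ j) :
    (Fin N → Fin d) ≃ (Fin d × Fin d) × ({k : Fin N // ∀ a, ![i, j] a ≠ k} → Fin d) :=
  (siteEquiv d ![i, j] (injective_pair hij)).trans
    (Equiv.prodCongr (finTwoArrowEquiv (Fin d)) (Equiv.refl _))

theorem isAmplification_embedGate {i j : Fin N} (hij : i ≠ j) (u : U (Fin d × Fin d)) :
    IsAmplification (pairEquiv d hij) u (embedGate i j hij u) := by
  intro x y
  refine if_congr ?_ rfl rfl
  change _ ↔ (fun k : {k : Fin N // ∀ a, ![i, j] a ≠ k} => x k) =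
    fun k : {k : Fin N // ∀ a, ![i, j] a ≠ k} => y k
  rw [funext_iff]
  simp only [Subtype.forall, Fin.forall_fin_two, Matrix.cons_val_zero, Matrix.cons_val_one]
  exact ⟨fun h k hk => h k hk.1.symm hk.2.symm, fun h k h1 h2 => h k ⟨h1.symm, h2.symm⟩⟩

theorem isAmplification_embedGate_embedGate {e : Fin m → Fin N} (he : Function.Injective e)
    {i j : Fin m} (hij : i ≠ j) (u : U (Fin d × Fin d)) :
    IsAmplification (siteEquiv d e he) (embedGate i j hij u)
      (embedGate (e i) (e j) (he.ne hij) u) := by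
  intro x y
  change (if ∀ k, k ≠ e i → k ≠ e j → x k = y k then u.1 (x (e i), x (e j)) (y (e i), y (e j))
    else 0) = if (fun k : {k : Fin N // ∀ i, e i ≠ k} => x k) =
        (fun k : {k : Fin N // ∀ i, e i ≠ k} => y k) then
      (if ∀ k, k ≠ i → k ≠ j → x (e k) = y (e k) then
        u.1 (x (e i), x (e j)) (y (e i), y (e j)) else 0) else 0
  rw [← ite_and]
  refine if_congr ?_ rfl rfl
  rw [funext_iff]
  simp only [Subtype.forall]
  constructor
  · exact fun h => ⟨fun k hk => h k (hk i).symm (hk j).symm,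
      fun k h1 h2 => h (e k) (he.ne h1) (he.ne h2)⟩
  · rintro ⟨h1, h2⟩ k hki hkj
    by_cases hk : ∃ a, e a = k
    · obtain ⟨a, rfl⟩ := hk
      exact h2 a (fun h => hki (h ▸ rfl)) (fun h => hkj (h ▸ rfl))
    · exact h1 k (not_exists.1 hk)

theorem embedGate_swap {i j : Fin N} (hij : i ≠ j) (u : U (Fin d × Fin d)) :
    embedGate j i hij.symm u =
      embedGate i j hij (reindexUnitary (Equiv.prodComm (Fin d) (Fin d)) u) := by
  apply Subtype.ext
  ext x y
  exact if_congr ⟨fun h k h1 h2 => h k h2 h1, fun h k h1 h2 => h k h2 h1⟩ rfl rfl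

theorem gateMatrix_mul_apply {i j k l : Fin N} (hik : i ≠ k) (hil : i ≠ l) (hjk : j ≠ k)
    (hjl : j ≠ l) (u v : Matrix (Fin d × Fin d) (Fin d × Fin d) ℂ) (x y : Fin N → Fin d) :
    (gateMatrix i j u * gateMatrix k l v) x y =
      if ∀ s, s ≠ i → s ≠ j → s ≠ k → s ≠ l → x s = y s then
        u (x i, x j) (y i, y j) * v (x k, x l) (y k, y l) else 0 := by
  rw [Matrix.mul_apply, Finset.sum_eq_single fun s => if s = i ∨ s = j then y s else x s]
  · have h1 : ∀ s, s ≠ i → s ≠ j → x s = if s = i ∨ s = j then y s else x s := by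
      intro s h1 h2
      simp [h1, h2]
    have h2 : (∀ s, s ≠ k → s ≠ l → (if s = i ∨ s = j then y s else x s) = y s) ↔
        ∀ s, s ≠ i → s ≠ j → s ≠ k → s ≠ l → x s = y s := by
      grind
    simp only [gateMatrix, Matrix.of_apply]
    rw [if_pos h1]
    simp only [h2, true_or, or_true, if_true, hik.symm, hjk.symm, hil.symm, hjl.symm, or_self,
      if_false, mul_ite, mul_zero]
  · intro z _ hz
    simp only [gateMatrix, Matrix.of_apply]
    by_cases h1 : ∀ s, s ≠ i → s ≠ j → x s = z s
    · by_cases h2 : ∀ s, s ≠ k → s ≠ l → z s = y s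
      · refine absurd (funext fun s => ?_) hz
        grind
      · rw [if_neg h2, mul_zero]
    · rw [if_neg h1, zero_mul]
  · simp

theorem commute_embedGate {i j k l : Fin N} (hij : i ≠ j) (hkl : k ≠ l) (hik : i ≠ k)
    (hil : i ≠ l) (hjk : j ≠ k) (hjl : j ≠ l) (u v : U (Fin d × Fin d)) :
    Commute (embedGate i j hij u) (embedGate k l hkl v) := by
  apply Subtype.ext
  ext x y
  change (gateMatrix i j u.1 * gateMatrix k l v.1) x y =
    (gateMatrix k l v.1 * gateMatrix i j u.1) x y
  rw [gateMatrix_mul_apply hik hil hjk hjl,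
    gateMatrix_mul_apply hik.symm hjk.symm hil.symm hjl.symm]
  refine if_congr ⟨fun h s h1 h2 h3 h4 => h s h3 h4 h1 h2, fun h s h1 h2 h3 h4 => h s h3 h4 h1 h2⟩
    (mul_comm _ _) rfl

/-- All gates on pairs of different sites related by `r`. -/
def gateSet (d : ℕ) (r : Fin N → Fin N → Prop) : Set (U (Fin N → Fin d)) :=
  {V | ∃ (i j : Fin N) (hij : i ≠ j) (u : U (Fin d × Fin d)), r i j ∧ V = embedGate i j hij u}

/-- The vectors of the moment space fixed by all gates on pairs of sites related by `r`. -/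
def gateInvariants (t d : ℕ) (r : Fin N → Fin N → Prop) :
    Submodule ℂ (MomentSpace t (Fin N → Fin d)) :=
  invariants t (gateSet d r)

/-- The projection onto `gateInvariants`. If `r` is the adjacency relation of a set of disjoint
pairs, this is the moment operator of the corresponding layer of Haar random gates. -/
noncomputable def gateProj (t d : ℕ) (r : Fin N → Fin N → Prop) :
    MomentSpace t (Fin N → Fin d) →L[ℂ] MomentSpace t (Fin N → Fin d) :=
  (gateInvariants t d r).starProjection

/-- All gates on the pair of sites `i`, `j` fix the vector `x`. -/
def GateFixes (x : MomentSpace t (Fin N → Fin d)) (i j : Fin N) : Prop :=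
  ∀ (hij : i ≠ j) (u : U (Fin d × Fin d)), rho t (embedGate i j hij u) x = x

theorem mem_gateInvariants {r : Fin N → Fin N → Prop} {x : MomentSpace t (Fin N → Fin d)} :
    x ∈ gateInvariants t d r ↔ ∀ i j, r i j → GateFixes x i j := by
  constructor
  · exact fun hx i j h hij u => hx _ ⟨i, j, hij, u, h, rfl⟩
  · rintro hx _ ⟨i, j, hij, u, h, rfl⟩
    exact hx i j h hij u

theorem GateFixes.symm {x : MomentSpace t (Fin N → Fin d)} {i j : Fin N} (h : GateFixes x i j) :
    GateFixes x j i := fun hij u => by rw [embedGate_swap hij.symm]; exact h _ _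

theorem gateFixes_self (x : MomentSpace t (Fin N → Fin d)) (i : Fin N) : GateFixes x i i :=
  fun h => absurd rfl h

theorem gateInvariants_anti {r s : Fin N → Fin N → Prop} (h : ∀ i j, r i j → s i j) :
    gateInvariants t d s ≤ gateInvariants t d r := fun x hx => by
  rw [mem_gateInvariants] at hx ⊢
  exact fun i j hij => hx i j (h i j hij)

theorem gateInvariants_or (r s : Fin N → Fin N → Prop) :
    gateInvariants t d (fun i j => r i j ∨ s i j) =
      gateInvariants t d r ⊓ gateInvariants t d s := by
  ext x
  simp only [Submodule.mem_inf, mem_gateInvariants, or_imp, forall_and]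

/-- Two relations between sites without common sites. -/
def SiteDisjoint (r s : Fin N → Fin N → Prop) : Prop :=
  ∀ i j k l, r i j → s k l → i ≠ k ∧ i ≠ l ∧ j ≠ k ∧ j ≠ l

theorem SiteDisjoint.commute_gateSet {r s : Fin N → Fin N → Prop} (h : SiteDisjoint r s) :
    ∀ V ∈ gateSet d r, ∀ W ∈ gateSet d s, Commute V W := by
  rintro _ ⟨i, j, hij, u, hr, rfl⟩ _ ⟨k, l, hkl, v, hs, rfl⟩
  obtain ⟨h1, h2, h3, h4⟩ := h i j k l hr hs
  exact commute_embedGate hij hkl h1 h2 h3 h4 u v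

theorem SiteDisjoint.commute {r s : Fin N → Fin N → Prop} (h : SiteDisjoint r s) :
    Commute (gateProj t d r) (gateProj t d s) :=
  commute_starProjection_invariants_invariants h.commute_gateSet

theorem SiteDisjoint.gateProj_mul {r s : Fin N → Fin N → Prop} (h : SiteDisjoint r s) :
    gateProj t d r * gateProj t d s = gateProj t d fun i j => r i j ∨ s i j :=
  starProjection_mul_eq_inf h.commute (gateInvariants_or r s)

end Gates

/-! ### Averages of the moment representation -/

section Average

variable {Ω Ω' ι κ : Type} [MeasurableSpace Ω] [MeasurableSpace Ω'] [Fintype ι] [DecidableEq ι]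
  [Fintype κ] [DecidableEq κ] {t : ℕ}

theorem continuous_rho : Continuous (rho t : U κ → MomentSpace t κ →L[ℂ] MomentSpace t κ) := by
  have h1 : Continuous fun M : Matrix ((Fin t → κ) × (Fin t → κ)) ((Fin t → κ) × (Fin t → κ)) ℂ =>
      Matrix.toEuclideanCLM (n := (Fin t → κ) × (Fin t → κ)) (𝕜 := ℂ) M :=
    LinearMap.continuous_of_finiteDimensional
      { toFun := Matrix.toEuclideanCLM (n := (Fin t → κ) × (Fin t → κ)) (𝕜 := ℂ)
        map_add' := map_add _
        map_smul' := map_smul _ }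
  have hV : ∀ i j, Continuous fun V : U κ => V.1 i j := fun i j =>
    (continuous_apply j).comp ((continuous_apply i).comp continuous_subtype_val)
  refine h1.comp (continuous_matrix fun a b => ?_)
  exact (continuous_finsetProd _ fun k _ => hV _ _).mul
    (continuous_finsetProd _ fun k _ => (hV _ _).star)

theorem integrable_rho {μ : Measure Ω} [IsFiniteMeasure μ] {φ : Ω → U κ} (hφ : Measurable φ) :
    Integrable (fun ω => rho t (φ ω)) μ := by
  refine Integrable.of_bound (C := 1) ?_ (Filter.Eventually.of_forall fun ω => norm_rho_le _)
  exact (continuous_rho.stronglyMeasurable.comp_measurable hφ).aestronglyMeasurable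

/-- The average of the moment representation over a random unitary `φ`. -/
noncomputable def average (t : ℕ) (μ : Measure Ω) (φ : Ω → U κ) :
    MomentSpace t κ →L[ℂ] MomentSpace t κ :=
  ∫ ω, rho t (φ ω) ∂μ

theorem average_apply {μ : Measure Ω} [IsFiniteMeasure μ] {φ : Ω → U κ} (hφ : Measurable φ)
    (x : MomentSpace t κ) : average t μ φ x = ∫ ω, rho t (φ ω) x ∂μ :=
  ContinuousLinearMap.integral_apply (integrable_rho hφ) x

theorem integrable_rho_apply {μ : Measure Ω} [IsFiniteMeasure μ] {φ : Ω → U κ}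
    (hφ : Measurable φ) (x : MomentSpace t κ) : Integrable (fun ω => rho t (φ ω) x) μ :=
  (integrable_rho hφ).apply_continuousLinearMap x

theorem norm_average_le {μ : Measure Ω} [IsProbabilityMeasure μ] (φ : Ω → U κ) :
    ‖average t μ φ‖ ≤ 1 := by
  have := norm_integral_le_of_norm_le_const (μ := μ) (f := fun ω => rho t (φ ω)) (C := 1)
    (Filter.Eventually.of_forall fun ω => norm_rho_le _)
  simpa [average] using this

theorem average_map {μ : Measure Ω} {φ : Ω → U κ} (hφ : Measurable φ) :
    average t (μ.map φ) id = average t μ φ := by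
  exact integral_map hφ.aemeasurable continuous_rho.stronglyMeasurable.aestronglyMeasurable

theorem average_apply_of_forall {μ : Measure Ω} [IsProbabilityMeasure μ] {φ : Ω → U κ}
    (hφ : Measurable φ) {x : MomentSpace t κ} (h : ∀ ω, rho t (φ ω) x = x) :
    average t μ φ x = x := by
  rw [average_apply hφ]
  simp [h]

theorem commute_average {μ : Measure Ω} [IsFiniteMeasure μ] {φ : Ω → U κ} (hφ : Measurable φ)
    {A : MomentSpace t κ →L[ℂ] MomentSpace t κ} (h : ∀ ω, Commute A (rho t (φ ω))) :
    Commute A (average t μ φ) := by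
  refine ContinuousLinearMap.ext fun x => ?_
  rw [mul_apply_eq_comp, mul_apply_eq_comp, average_apply hφ, average_apply hφ,
    ← A.integral_comp_comm (integrable_rho_apply hφ x)]
  exact integral_congr_ae (Filter.Eventually.of_forall fun ω => congr($((h ω).eq) x))

theorem starProjection_mul_average {μ : Measure Ω} [IsProbabilityMeasure μ] {φ : Ω → U κ}
    (hφ : Measurable φ) {S : Set (U κ)} (h : ∀ ω, φ ω ∈ S) :
    (invariants t S).starProjection * average t μ φ = (invariants t S).starProjection := by
  refine ContinuousLinearMap.ext fun x => ?_
  rw [mul_apply_eq_comp, average_apply hφ,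
    ← ContinuousLinearMap.integral_comp_comm _ (integrable_rho_apply hφ x)]
  have key : ∀ ω, (invariants t S).starProjection (rho t (φ ω) x) =
      (invariants t S).starProjection x := by
    intro ω
    refine Submodule.eq_starProjection_of_mem_orthogonal
      ((invariants t S).starProjection_apply_mem x) fun w hw => ?_
    have h1 : rho t (φ ω)⁻¹ w = w := by
      conv_lhs => rw [← hw _ (h ω)]
      exact rho_inv_apply_self _ _
    have h2 := (invariants t S).sub_starProjection_mem_orthogonal x w hw
    rw [inner_sub_right] at h2 ⊢
    rw [← ContinuousLinearMap.adjoint_inner_left, adjoint_rho, h1, h2]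
  simp [key]

theorem average_mul_starProjection {μ : Measure Ω} [IsProbabilityMeasure μ] {φ : Ω → U κ}
    (hφ : Measurable φ) {S : Set (U κ)} (h : ∀ ω, φ ω ∈ S) :
    average t μ φ * (invariants t S).starProjection = (invariants t S).starProjection := by
  refine ContinuousLinearMap.ext fun x => ?_
  rw [mul_apply_eq_comp]
  exact average_apply_of_forall hφ fun ω =>
    (invariants t S).starProjection_apply_mem x _ (h ω)

theorem fiber_average {τ : Type} [Fintype τ] [DecidableEq τ] {σ : κ ≃ ι × τ} {μ : Measure Ω}
    [IsFiniteMeasure μ] {φ : Ω → U ι} {ψ : Ω → U κ} (hφ : Measurable φ) (hψ : Measurable ψ)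
    (h : ∀ ω, IsAmplification σ (φ ω) (ψ ω)) (z : (Fin t → τ) × (Fin t → τ))
    (x : MomentSpace t κ) :
    fiber σ z (average t μ ψ x) = average t μ φ (fiber σ z x) := by
  rw [average_apply hφ, average_apply hψ,
    ← (fiber σ z).integral_comp_comm (integrable_rho_apply hψ x)]
  exact integral_congr_ae (Filter.Eventually.of_forall fun ω => fiber_rho (h ω) z x)

/-- By the invariance of the Haar measure, the Haar average maps into the invariant vectors. -/
theorem average_haar :
    average t (haarEnsemble ι : Measure (U ι)) id = (invariants t Set.univ).starProjection := by
  have hinv : (haarEnsemble ι : Measure (U ι)).IsMulLeftInvariant := by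
    change (Measure.haarMeasure (⊤ : TopologicalSpace.PositiveCompacts (U ι))).IsMulLeftInvariant
    infer_instance
  have h1 : ∀ x, average t (haarEnsemble ι : Measure (U ι)) id x ∈
      invariants t (Set.univ : Set (U ι)) := by
    intro x V _
    rw [average_apply measurable_id, ← (rho t V).integral_comp_comm
      (integrable_rho_apply measurable_id x)]
    simp only [id, ← mul_apply_eq_comp, ← map_mul]
    exact integral_mul_left_eq_self (fun W : U ι => rho t W x) V
  have h2 := starProjection_mul_average (t := t) (μ := (haarEnsemble ι : Measure (U ι)))
    measurable_id (S := Set.univ) fun _ => Set.mem_univ _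
  rw [← h2]
  refine ContinuousLinearMap.ext fun x => ?_
  exact (Submodule.starProjection_eq_self_iff.2 (h1 x)).symm

theorem toEuclideanCLM_momentOperator (ν : Measure (U ι)) [IsFiniteMeasure ν] :
    Matrix.toEuclideanCLM (n := (Fin t → ι) × (Fin t → ι)) (𝕜 := ℂ) (momentOperator t ν) =
      average t ν id := by
  refine ContinuousLinearMap.ext fun x => ?_
  ext a
  have h1 : ∀ b, Integrable (fun V : U ι => tensorPower t V a b) ν := by
    intro b
    have := (EuclideanSpace.proj (𝕜 := ℂ) a).integrable_comp
      (integrable_rho_apply (μ := ν) measurable_id (EuclideanSpace.single b (1 : ℂ)))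
    refine this.congr (Filter.Eventually.of_forall fun V => ?_)
    simp [rho_apply]
  rw [average_apply measurable_id]
  have h2 := (EuclideanSpace.proj (𝕜 := ℂ) a).integral_comp_comm
      (integrable_rho_apply (μ := ν) measurable_id x)
  refine Eq.trans ?_ h2
  change _ = ∫ V : U ι, ∑ b, tensorPower t V a b * x b ∂ν
  rw [integral_finsetSum _ fun b _ => (h1 b).mul_const _]
  simp only [integral_mul_const]
  rfl

theorem spectralGap_eq (ν : Measure (U ι)) [IsFiniteMeasure ν] :
    spectralGap t ν = 1 - ‖average t ν id - (invariants t Set.univ).starProjection‖ := by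
  rw [spectralGap, opNorm, map_sub, toEuclideanCLM_momentOperator, toEuclideanCLM_momentOperator,
    average_haar]

theorem spectralGap_le_one (ν : Measure (U ι)) : spectralGap t ν ≤ 1 := by
  rw [spectralGap, opNorm]
  linarith [norm_nonneg (Matrix.toEuclideanCLM (n := (Fin t → ι) × (Fin t → ι)) (𝕜 := ℂ)
    (momentOperator t ν - momentOperator t (haarEnsemble ι : Measure (U ι))))]

/-- The moment operator agrees with the Haar projection on the invariant vectors and is a contraction
on their complement. -/
theorem spectralGap_nonneg (ν : Measure (U ι)) [IsProbabilityMeasure ν] :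
    0 ≤ spectralGap t ν := by
  rw [spectralGap_eq, sub_nonneg]
  have h1 := average_mul_starProjection (t := t) (μ := ν) measurable_id (S := Set.univ)
    fun _ => Set.mem_univ _
  set P := (invariants t (Set.univ : Set (U ι))).starProjection with hP
  have h2 : average t ν id - P = average t ν id * (1 - P) := by rw [mul_sub, mul_one, h1]
  have h3 : ‖1 - P‖ ≤ 1 := by
    rw [hP, ← Submodule.starProjection_orthogonal']
    exact norm_starProjection_le_one _
  rw [h2]
  exact (norm_mul_le _ _).trans (mul_le_one₀ (norm_average_le _) (norm_nonneg _) h3)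

theorem average_prod_mul {μ : Measure Ω} {ν : Measure Ω'} [IsFiniteMeasure μ] [IsFiniteMeasure ν]
    {φ : Ω → U κ} {ψ : Ω' → U κ} (hφ : Measurable φ) (hψ : Measurable ψ) :
    average t (μ.prod ν) (fun p => φ p.1 * ψ p.2) = average t μ φ * average t ν ψ := by
  have := integral_prod_bilin (μ := μ) (ν := ν)
    (B := ContinuousLinearMap.mul ℂ (MomentSpace t κ →L[ℂ] MomentSpace t κ))
    (integrable_rho (t := t) (μ := μ) hφ) (integrable_rho (t := t) (μ := ν) hψ)
  simp only [ContinuousLinearMap.mul_apply', ← map_mul] at this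
  exact this

theorem average_mconv (μ ν : Measure (U κ)) [IsFiniteMeasure μ] [IsFiniteMeasure ν] :
    average t (μ ∗ₘ ν) id = average t μ id * average t ν id := by
  have h : Measurable fun p : U κ × U κ => p.1 * p.2 := by fun_prop
  rw [Measure.mconv, average_map h]
  exact average_prod_mul (t := t) (μ := μ) (ν := ν) (φ := fun V : U κ => V) (ψ := fun V : U κ => V)
    measurable_id measurable_id

theorem average_dirac_one : average t (Measure.dirac (1 : U κ)) id = 1 := by
  have h : StronglyMeasurable fun V : U κ => rho t (id V) := continuous_rho.stronglyMeasurable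
  exact (integral_dirac' _ _ h).trans (map_one (rho t))

theorem measurable_list_prod {n : ℕ} {φ : Fin n → Ω → U κ} (hφ : ∀ g, Measurable (φ g)) :
    Measurable fun u : Fin n → Ω => (List.ofFn fun g => φ g (u g)).prod := by
  induction n with
  | zero => simp
  | succ n ih =>
    simp only [List.ofFn_succ, List.prod_cons]
    exact ((hφ 0).comp (measurable_pi_apply 0)).mul
      ((ih fun g => hφ g.succ).comp (measurable_pi_lambda _ fun g => measurable_pi_apply _))

/-- Independent random unitaries: the average of the product is the product of the averages. -/
theorem average_pi {n : ℕ} {φ : Fin n → Ω → U κ} (hφ : ∀ g, Measurable (φ g))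
    (μ : Fin n → Measure Ω) [∀ g, IsProbabilityMeasure (μ g)] :
    average t (Measure.pi μ) (fun u => (List.ofFn fun g => φ g (u g)).prod) =
      (List.ofFn fun g => average t (μ g) (φ g)).prod := by
  induction n with
  | zero => simp [average]
  | succ n ih =>
    have h := (measurePreserving_piFinSuccAbove μ 0).integral_comp'
      (fun p : Ω × (Fin n → Ω) => rho t (φ 0 p.1 * (List.ofFn fun g => φ g.succ (p.2 g)).prod))
    rw [List.ofFn_succ, List.prod_cons, ← ih fun g => hφ g.succ,
      ← average_prod_mul (hφ 0) (measurable_list_prod fun g => hφ g.succ)]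
    simp only [average]
    simp only [Fin.zero_succAbove] at h
    rw [← h]
    simp only [List.ofFn_succ, List.prod_cons]
    rfl

end Average

/-! ### Moment operators of layers, circuits and the brickwork -/

section Layers

variable {N m d t : ℕ}

theorem measurable_embedGate {i j : Fin N} (hij : i ≠ j) :
    Measurable (embedGate (d := d) i j hij) := by
  refine Continuous.measurable ?_
  refine Continuous.subtype_mk (continuous_matrix fun x y => ?_) _
  simp only [gateMatrix, Matrix.of_apply]
  split_ifs
  · exact (continuous_apply _).comp ((continuous_apply _).comp continuous_subtype_val)
  · exact continuous_const

/-- The moment operator of a random gate is as close to the projection onto the vectors fixed by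
all gates at its position as it is for an isolated pair of qudits. -/
theorem norm_average_embedGate_sub_le {i j : Fin N} (hij : i ≠ j)
    (ν : Measure (U (Fin d × Fin d))) [IsProbabilityMeasure ν] :
    ‖average t ν (embedGate i j hij) - gateProj t d fun a b => i = a ∧ j = b‖ ≤
      1 - spectralGap t ν := by
  rw [spectralGap_eq, sub_sub_cancel]
  refine norm_le_of_fiber (σ := pairEquiv d hij) fun z x => ?_
  have h1 := fiber_average (t := t) (μ := ν) (φ := id) measurable_id (measurable_embedGate hij)
    (isAmplification_embedGate hij) z x
  have h2 := fiber_starProjection (mem_invariants_iff_fiber (t := t) (σ := pairEquiv d hij)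
    (S := Set.univ) (T := gateSet d fun a b => i = a ∧ j = b)
    (fun u _ => ⟨_, ⟨i, j, hij, u, ⟨rfl, rfl⟩, rfl⟩, isAmplification_embedGate hij u⟩) (by
      rintro _ ⟨_, _, _, u, ⟨rfl, rfl⟩, rfl⟩
      exact ⟨u, Set.mem_univ _, isAmplification_embedGate hij u⟩)) z x
  simp only [sub_apply, map_sub, h1]
  rw [← h2]
  rfl

/-- The relation between the two sites of each gate. -/
def gateRel {n : ℕ} (s : Fin n × Fin 2 → Fin N) (i j : Fin N) : Prop :=
  ∃ g, s (g, 0) = i ∧ s (g, 1) = j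

theorem norm_list_prod_le_one {A : Type*} [NormedRing A] {l : List A} (h₁ : ‖(1 : A)‖ ≤ 1)
    (h : ∀ a ∈ l, ‖a‖ ≤ 1) : ‖l.prod‖ ≤ 1 := by
  induction l with
  | nil => simpa using h₁
  | cons a l ih =>
    rw [List.prod_cons]
    exact (norm_mul_le _ _).trans (mul_le_one₀ (h a (by simp)) (norm_nonneg _)
      (ih fun b hb => h b (by simp [hb])))

theorem site_pair_ne {n : ℕ} {s : Fin n × Fin 2 → Fin N} (hs : Function.Injective s) (g : Fin n) :
    s (g, 0) ≠ s (g, 1) := fun h => by simpa using hs h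

theorem gateProj_false : gateProj t d (fun _ _ : Fin N => False) = 1 := by
  refine ContinuousLinearMap.ext fun x => Submodule.starProjection_eq_self_iff.2 ?_
  rw [gateInvariants, mem_invariants]
  rintro _ ⟨_, _, _, _, h, _⟩
  exact h.elim

theorem gateProj_congr {r s : Fin N → Fin N → Prop} (h : ∀ i j, r i j ↔ s i j) :
    gateProj t d r = gateProj t d s := by
  rw [show r = s from funext fun i => funext fun j => propext (h i j)]

/-- Gates without common sites: since they commute, the gap of their product is at least the smallest
one of the gates. -/
theorem norm_list_prod_sub_gateProj_le {n : ℕ} {s : Fin n × Fin 2 → Fin N}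
    (hs : Function.Injective s) (ν : Fin n → ProbabilityMeasure (U (Fin d × Fin d))) {ε : ℝ}
    (hε : 0 ≤ ε) (h : ∀ g, 1 - spectralGap t (ν g : Measure (U (Fin d × Fin d))) ≤ ε) :
    ‖(List.ofFn fun g => average t (ν g : Measure (U (Fin d × Fin d)))
      (embedGate _ _ (site_pair_ne hs g))).prod - gateProj t d (gateRel s)‖ ≤ ε := by
  induction n with
  | zero =>
    rw [gateProj_congr (s := fun _ _ => False) fun i j => by simp [gateRel], gateProj_false]
    simpa using hε
  | succ n ih =>
    let s' : Fin n × Fin 2 → Fin N := fun p => s (p.1.succ, p.2)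
    have hs' : Function.Injective s' := fun p q hpq => by
      have := hs hpq
      simpa [Prod.ext_iff] using this
    let r : Fin N → Fin N → Prop := fun a b => s (0, 0) = a ∧ s (0, 1) = b
    have hr : SiteDisjoint r (gateRel s') := by
      rintro _ _ _ _ ⟨rfl, rfl⟩ ⟨g, rfl, rfl⟩
      have h0 : ∀ a b, s (0, a) ≠ s' (g, b) := fun a b h => by
        have := hs h
        simp [Prod.ext_iff, Fin.ext_iff] at this
      exact ⟨h0 _ _, h0 _ _, h0 _ _, h0 _ _⟩
    rw [List.ofFn_succ, List.prod_cons,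
      gateProj_congr (s := fun i j => r i j ∨ gateRel s' i j) fun i j => by
        simp [gateRel, r, s', Fin.exists_fin_succ], ← hr.gateProj_mul]
    have hmem : ∀ g (u : U (Fin d × Fin d)),
        embedGate _ _ (site_pair_ne hs (Fin.succ g)) u ∈ gateSet d (gateRel s') :=
      fun g u => ⟨_, _, _, u, ⟨g, rfl, rfl⟩, rfl⟩
    have hmem0 : ∀ u : U (Fin d × Fin d), embedGate _ _ (site_pair_ne hs 0) u ∈ gateSet d r :=
      fun u => ⟨_, _, _, u, ⟨rfl, rfl⟩, rfl⟩
    have hcomm := hr.commute_gateSet (d := d)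
    refine norm_mul_sub_mul_le hε ?_ ?_ hr.commute
      (average_mul_starProjection (measurable_embedGate _) hmem0)
      (starProjection_mul_average (measurable_embedGate _) hmem0) ?_
      ((norm_average_embedGate_sub_le _ _).trans (h 0)) (ih hs' _ fun g => h g.succ)
    · refine Commute.list_prod_right _ _ fun B hB => ?_
      obtain ⟨g, rfl⟩ := List.mem_ofFn.1 hB
      refine commute_average (measurable_embedGate _) fun u => ?_
      exact (commute_average (measurable_embedGate _) fun v =>
        (hcomm _ (hmem0 v) _ (hmem g u)).symm.map (rho t)).symm
    · refine Commute.list_prod_right _ _ fun B hB => ?_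
      obtain ⟨g, rfl⟩ := List.mem_ofFn.1 hB
      refine commute_average (measurable_embedGate _) fun u => ?_
      exact (commute_starProjection_invariants fun V hV =>
        (hcomm V hV _ (hmem g u)).symm.map (rho t)).symm
    · refine norm_list_prod_le_one ContinuousLinearMap.norm_id_le fun B hB => ?_
      obtain ⟨g, rfl⟩ := List.mem_ofFn.1 hB
      exact norm_average_le _

theorem Layer.measurable_unitary (L : Layer N) : Measurable (L.unitary (d := d)) :=
  measurable_list_prod fun _ => measurable_embedGate _

theorem Layer.isProbabilityMeasure_ensemble (L : Layer N)
    (ν : Fin L.numGates → ProbabilityMeasure (U (Fin d × Fin d))) :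
    IsProbabilityMeasure (L.ensemble ν) :=
  Measure.isProbabilityMeasure_map L.measurable_unitary.aemeasurable

theorem Layer.average_ensemble (L : Layer N)
    (ν : Fin L.numGates → ProbabilityMeasure (U (Fin d × Fin d))) :
    average t (L.ensemble ν) id = (List.ofFn fun g => average t (ν g : Measure (U (Fin d × Fin d)))
      (embedGate _ _ (L.site_ne g))).prod := by
  rw [Layer.ensemble, average_map L.measurable_unitary]
  exact average_pi (fun g => measurable_embedGate _) _

/-- The gap of a layer is at least the smallest one of its gates. -/
theorem Layer.norm_average_ensemble_sub_le (L : Layer N)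
    (ν : Fin L.numGates → ProbabilityMeasure (U (Fin d × Fin d))) {ε : ℝ}
    (hε : 0 ≤ ε) (h : ∀ g, 1 - spectralGap t (ν g : Measure (U (Fin d × Fin d))) ≤ ε) :
    ‖average t (L.ensemble ν) id - gateProj t d (gateRel L.site)‖ ≤ ε := by
  rw [L.average_ensemble]
  exact norm_list_prod_sub_gateProj_le L.site_injective ν hε h

theorem gateRel_unitary_apply (L : Layer N)
    (u : Fin L.numGates → U (Fin d × Fin d)) {x : MomentSpace t (Fin N → Fin d)}
    (hx : x ∈ gateInvariants t d (gateRel L.site)) : rho t (L.unitary u) x = x := by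
  rw [Layer.unitary, map_list_prod]
  have h : ∀ l : List (MomentSpace t (Fin N → Fin d) →L[ℂ] MomentSpace t (Fin N → Fin d)),
      (∀ A ∈ l, A x = x) → l.prod x = x := by
    intro l
    induction l with
    | nil => simp
    | cons A l ih =>
      intro h
      rw [List.prod_cons, mul_apply_eq_comp, ih fun B hB => h B (by simp [hB]), h A (by simp)]
  refine h _ fun A hA => ?_
  obtain ⟨V, hV, rfl⟩ := List.mem_map.1 hA
  obtain ⟨g, rfl⟩ := List.mem_ofFn.1 hV
  exact hx _ ⟨_, _, _, u g, ⟨g, rfl, rfl⟩, rfl⟩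

theorem invariants_range_unitary_ge (L : Layer N) :
    gateInvariants t d (gateRel L.site) ≤ invariants t (Set.range (L.unitary (d := d))) := by
  rintro x hx _ ⟨u, rfl⟩
  exact gateRel_unitary_apply L u hx

theorem Layer.average_mul_gateProj (L : Layer N)
    (ν : Fin L.numGates → ProbabilityMeasure (U (Fin d × Fin d))) {r : Fin N → Fin N → Prop}
    (hr : gateInvariants t d r ≤ gateInvariants t d (gateRel L.site)) :
    average t (L.ensemble ν) id * gateProj t d r = gateProj t d r := by
  have h := hr.trans (invariants_range_unitary_ge L)
  rw [Layer.ensemble, average_map L.measurable_unitary, gateProj, ← starProjection_mul_of_le h,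
    ← mul_assoc, average_mul_starProjection L.measurable_unitary Set.mem_range_self]

theorem Layer.gateProj_mul_average (L : Layer N)
    (ν : Fin L.numGates → ProbabilityMeasure (U (Fin d × Fin d))) {r : Fin N → Fin N → Prop}
    (hr : gateInvariants t d r ≤ gateInvariants t d (gateRel L.site)) :
    gateProj t d r * average t (L.ensemble ν) id = gateProj t d r := by
  have h := hr.trans (invariants_range_unitary_ge L)
  rw [Layer.ensemble, average_map L.measurable_unitary, gateProj, ← starProjection_mul_of_ge h,
    mul_assoc, starProjection_mul_average L.measurable_unitary Set.mem_range_self]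

theorem spectralGap_haarEnsemble {ι : Type} [Fintype ι] [DecidableEq ι] :
    spectralGap t (haarEnsemble ι : Measure (U ι)) = 1 := by
  rw [spectralGap_eq, average_haar, sub_self, norm_zero, sub_zero]

theorem Layer.average_ensemble_haar (L : Layer N) :
    average t (L.ensemble fun _ => haarEnsemble (Fin d × Fin d)) id =
      gateProj t d (gateRel L.site) := by
  have h := L.norm_average_ensemble_sub_le (t := t) (fun _ => haarEnsemble (Fin d × Fin d))
    le_rfl fun g => by rw [spectralGap_haarEnsemble, sub_self]
  exact sub_eq_zero.1 (norm_le_zero_iff.1 h)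

/-- The law of the product `V_l ⋯ V_2 V_1` of independent random unitaries with the laws `M`; for the
layers of an architecture it is `circuitEnsemble` by definition. -/
noncomputable def composition {ι : Type} [Fintype ι] [DecidableEq ι] {l : ℕ}
    (M : Fin l → Measure (U ι)) : Measure (U ι) :=
  (List.ofFn M).foldl (fun acc μ => μ ∗ₘ acc) (Measure.dirac 1)

theorem composition_succ {ι : Type} [Fintype ι] [DecidableEq ι] {l : ℕ}
    (M : Fin (l + 1) → Measure (U ι)) :
    composition M = M (Fin.last l) ∗ₘ composition fun j => M j.castSucc := by
  rw [composition, List.ofFn_succ', List.concat_eq_append, List.foldl_append]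
  rfl

theorem isProbabilityMeasure_composition {ι : Type} [Fintype ι] [DecidableEq ι] {l : ℕ}
    (M : Fin l → Measure (U ι)) (hM : ∀ j, IsProbabilityMeasure (M j)) :
    IsProbabilityMeasure (composition M) := by
  induction l with
  | zero =>
    rw [composition, List.ofFn_zero]
    exact Measure.dirac.isProbabilityMeasure
  | succ l ih =>
    rw [composition_succ]
    have := ih (fun j => M j.castSucc) fun j => hM _
    have := hM (Fin.last l)
    infer_instance

theorem average_composition_zero {ι : Type} [Fintype ι] [DecidableEq ι]
    (M : Fin 0 → Measure (U ι)) : average t (composition M) id = 1 := by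
  rw [composition, List.ofFn_zero]
  exact average_dirac_one

theorem average_composition_succ {ι : Type} [Fintype ι] [DecidableEq ι] {l : ℕ}
    (M : Fin (l + 1) → Measure (U ι)) (hM : ∀ j, IsProbabilityMeasure (M j)) :
    average t (composition M) id = average t (M (Fin.last l)) id *
      average t (composition fun j => M j.castSucc) id := by
  have := isProbabilityMeasure_composition (fun j => M j.castSucc) fun j => hM _
  have := hM (Fin.last l)
  rw [composition_succ, average_mconv]

/-- The edges `(k, k + 1)` of a path for `k` even (`c = 0`) or odd (`c = 1`). -/
def pathRel (m c : ℕ) (i j : Fin m) : Prop := i.1 + 1 = j.1 ∧ i.1 % 2 = c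

theorem gateRel_brickwork_zero (m : ℕ) (i j : Fin m) :
    gateRel (brickwork m 0).site i j ↔ pathRel m 0 i j := by
  constructor
  · rintro ⟨g, rfl, rfl⟩
    exact ⟨rfl, by simp [brickwork]⟩
  · rintro ⟨h1, h2⟩
    refine ⟨(⟨i.1 / 2, by omega⟩ : Fin (m / 2)), ?_, ?_⟩ <;>
      apply Fin.ext <;> simp [brickwork] <;> omega

theorem gateRel_brickwork_one (m : ℕ) (i j : Fin m) :
    gateRel (brickwork m 1).site i j ↔ pathRel m 1 i j := by
  constructor
  · rintro ⟨g, rfl, rfl⟩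
    exact ⟨rfl, by simp [brickwork]⟩
  · rintro ⟨h1, h2⟩
    refine ⟨(⟨i.1 / 2, by omega⟩ : Fin ((m - 1) / 2)), ?_, ?_⟩ <;>
      apply Fin.ext <;> simp [brickwork] <;> omega

theorem haarBrickworkGap_eq (t m d : ℕ) :
    haarBrickworkGap t m d = 1 - ‖gateProj t d (pathRel m 1) * gateProj t d (pathRel m 0) -
      (invariants t (Set.univ : Set (U (Fin m → Fin d)))).starProjection‖ := by
  have hM : ∀ j, IsProbabilityMeasure
      ((brickwork m j).ensemble fun _ => haarEnsemble (Fin d × Fin d)) :=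
    fun j => Layer.isProbabilityMeasure_ensemble _ _
  have h0 : circuitEnsemble (brickwork m) (fun _ _ => haarEnsemble (Fin d × Fin d)) =
      composition fun j => (brickwork m j).ensemble fun _ => haarEnsemble (Fin d × Fin d) := rfl
  have := isProbabilityMeasure_composition _ hM
  rw [haarBrickworkGap, h0, spectralGap_eq, average_composition_succ _ hM,
    average_composition_succ _ fun j => hM j.castSucc, average_composition_zero, mul_one]
  rw [Layer.average_ensemble_haar, Layer.average_ensemble_haar]
  rw [← gateProj_congr (gateRel_brickwork_zero m), ← gateProj_congr (gateRel_brickwork_one m)]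
  rfl

end Layers

/-! ### Gaps of pairs of partitions of the sites -/

section Gaps

variable {N m d t : ℕ}

/-- On the complement of `M` in `K ⊓ L` the product of the projections acts as the identity, which is
impossible if it is close to the projection onto `M`. -/
theorem inf_le_of_norm_sub_lt_one {E : Type*} [NormedAddCommGroup E] [InnerProductSpace ℂ E]
    [FiniteDimensional ℂ E] {K L M : Submodule ℂ E} (hMK : M ≤ K) (hML : M ≤ L)
    (h : ‖K.starProjection * L.starProjection - M.starProjection‖ < 1) : K ⊓ L ≤ M := by
  rintro x ⟨hK, hL⟩
  set y := x - M.starProjection x with hy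
  have hM := M.starProjection_apply_mem x
  have h1 : K.starProjection y = y :=
    Submodule.starProjection_eq_self_iff.2 (K.sub_mem hK (hMK hM))
  have h2 : L.starProjection y = y :=
    Submodule.starProjection_eq_self_iff.2 (L.sub_mem hL (hML hM))
  have h3 : M.starProjection y = 0 := by
    rw [hy, map_sub, Submodule.starProjection_eq_self_iff.2 hM, sub_self]
  have h4 := (K.starProjection * L.starProjection - M.starProjection).le_opNorm y
  rw [sub_apply, mul_apply_eq_comp, h2, h1, h3, sub_zero] at h4
  have h5 : y = 0 := by
    by_contra hne
    have := norm_pos_iff.2 hne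
    nlinarith
  rw [sub_eq_zero.1 h5]
  exact hM

theorem invariants_univ_le (r : Fin N → Fin N → Prop) :
    invariants t Set.univ ≤ gateInvariants t d r :=
  invariants_anti (Set.subset_univ _)

/-- If the Haar random brickwork has a positive gap, then the gates along the path of sites
generate all unitaries, as far as fixed vectors are concerned. -/
theorem gateInvariants_path_le (h : 0 < haarBrickworkGap t m d) :
    gateInvariants t d (pathRel m 1) ⊓ gateInvariants t d (pathRel m 0) ≤
      invariants t Set.univ := by
  rw [haarBrickworkGap_eq, sub_pos] at h
  exact inf_le_of_norm_sub_lt_one (invariants_univ_le _) (invariants_univ_le _) h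

theorem mem_gateInvariants_map_iff {e : Fin m → Fin N} (he : Function.Injective e)
    {r : Fin m → Fin m → Prop} (x : MomentSpace t (Fin N → Fin d)) :
    x ∈ gateInvariants t d (Relation.Map r e e) ↔
      ∀ z, fiber (siteEquiv d e he) z x ∈ gateInvariants t d r := by
  refine mem_invariants_iff_fiber ?_ ?_ x
  · rintro _ ⟨i, j, hij, u, h, rfl⟩
    exact ⟨_, ⟨e i, e j, he.ne hij, u, ⟨i, j, h, rfl, rfl⟩, rfl⟩,
      isAmplification_embedGate_embedGate he hij u⟩
  · rintro _ ⟨_, _, hij, u, ⟨i, j, h, rfl, rfl⟩, rfl⟩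
    have hij' : i ≠ j := fun h => hij (h ▸ rfl)
    exact ⟨_, ⟨i, j, hij', u, h, rfl⟩, isAmplification_embedGate_embedGate he hij' u⟩

theorem gateInvariants_map_path_le {e : Fin m → Fin N} (he : Function.Injective e)
    (h : 0 < haarBrickworkGap t m d) :
    gateInvariants t d (Relation.Map (pathRel m 1) e e) ⊓
      gateInvariants t d (Relation.Map (pathRel m 0) e e) ≤
      gateInvariants t d (Relation.Map (fun _ _ => True) e e) := by
  rintro x ⟨h1, h0⟩
  rw [SetLike.mem_coe, mem_gateInvariants_map_iff he] at h1 h0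
  rw [mem_gateInvariants_map_iff he]
  exact fun z => invariants_univ_le _ (gateInvariants_path_le h ⟨h1 z, h0 z⟩)

/-- The gap of a brickwork does not change if its sites are placed along a path `e` of a larger
system. -/
theorem norm_path_sub_le {e : Fin m → Fin N} (he : Function.Injective e)
    (h : 0 < haarBrickworkGap t m d) :
    ‖gateProj t d (Relation.Map (pathRel m 1) e e) *
        gateProj t d (Relation.Map (pathRel m 0) e e) -
      gateProj t d (Relation.Map (fun _ _ => True) e e)‖ ≤ 1 - haarBrickworkGap t m d := by
  rw [haarBrickworkGap_eq, sub_sub_cancel]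
  have key : ∀ (r : Fin m → Fin m → Prop) z (x : MomentSpace t (Fin N → Fin d)),
      fiber (siteEquiv d e he) z (gateProj t d (Relation.Map r e e) x) =
        gateProj t d r (fiber (siteEquiv d e he) z x) :=
    fun r z x => fiber_starProjection (mem_gateInvariants_map_iff he) z x
  have htop : gateInvariants t d (fun _ _ : Fin m => True) = invariants t Set.univ :=
    le_antisymm ((le_inf (gateInvariants_anti fun _ _ _ => trivial)
      (gateInvariants_anti fun _ _ _ => trivial)).trans (gateInvariants_path_le h))
      (invariants_univ_le _)
  have htop' : gateProj t d (fun _ _ : Fin m => True) =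
      (invariants t (Set.univ : Set (U (Fin m → Fin d)))).starProjection := by
    simp only [gateProj, htop]
  rw [← htop']
  refine norm_le_of_fiber (σ := siteEquiv d e he) fun z x => ?_
  simp only [sub_apply, map_sub, mul_apply_eq_comp, key]

theorem star_gateProj (r : Fin N → Fin N → Prop) : star (gateProj t d r) = gateProj t d r :=
  (isSelfAdjoint_starProjection _).star_eq

theorem norm_path_sub_le' {e : Fin m → Fin N} (he : Function.Injective e)
    (h : 0 < haarBrickworkGap t m d) :
    ‖gateProj t d (Relation.Map (pathRel m 0) e e) *
        gateProj t d (Relation.Map (pathRel m 1) e e) -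
      gateProj t d (Relation.Map (fun _ _ => True) e e)‖ ≤ 1 - haarBrickworkGap t m d := by
  rw [← norm_star, star_sub, star_mul, star_gateProj, star_gateProj, star_gateProj]
  exact norm_path_sub_le he h

/-- A larger pair of partitions with the same join has at least the same gap. -/
theorem norm_gateProj_mul_sub_mono {p q p' q' J : Fin N → Fin N → Prop} {ε : ℝ}
    (hp : ∀ i j, p' i j → p i j) (hq : ∀ i j, q' i j → q i j) (hpJ : ∀ i j, p i j → J i j)
    (hqJ : ∀ i j, q i j → J i j)
    (h : ‖gateProj t d p' * gateProj t d q' - gateProj t d J‖ ≤ ε) :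
    ‖gateProj t d p * gateProj t d q - gateProj t d J‖ ≤ ε := by
  have h1 : gateProj t d p * gateProj t d p' = gateProj t d p :=
    starProjection_mul_of_ge (gateInvariants_anti hp)
  have h2 : gateProj t d q' * gateProj t d q = gateProj t d q :=
    starProjection_mul_of_le (gateInvariants_anti hq)
  have h3 : gateProj t d p * gateProj t d J = gateProj t d J :=
    starProjection_mul_of_le (gateInvariants_anti hpJ)
  have h4 : gateProj t d J * gateProj t d q = gateProj t d J :=
    starProjection_mul_of_ge (gateInvariants_anti hqJ)
  have e : gateProj t d p * gateProj t d q - gateProj t d J =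
      gateProj t d p * (gateProj t d p' * gateProj t d q' - gateProj t d J) * gateProj t d q := by
    rw [mul_sub, sub_mul, h3, h4, ← mul_assoc, h1, mul_assoc, h2]
  have hε : 0 ≤ ε := (norm_nonneg _).trans h
  rw [e]
  refine (norm_mul_le _ _).trans ?_
  refine (mul_le_mul (norm_mul_le _ _) (norm_starProjection_le_one _) (norm_nonneg _)
    (by positivity)).trans ?_
  rw [mul_one]
  exact (mul_le_mul (norm_starProjection_le_one _) h (norm_nonneg _) zero_le_one).trans_eq
    (one_mul _)

theorem gateProj_eq_one {r : Fin N → Fin N → Prop} (h : ∀ i j, r i j → i = j) :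
    gateProj t d r = 1 := by
  refine ContinuousLinearMap.ext fun x => Submodule.starProjection_eq_self_iff.2 ?_
  rw [mem_gateInvariants]
  intro i j hij
  rw [h i j hij]
  exact gateFixes_self x j

theorem fComplete_le (hm : 2 ≤ m) (hmN : m ≤ N) : fComplete N t d ≤ haarBrickworkGap t m d :=
  ciInf_le (f := fun m : Finset.Icc 2 N => haarBrickworkGap t m d) (Set.finite_range _).bddBelow
    ⟨m, Finset.mem_Icc.2 ⟨hm, hmN⟩⟩

/-- The gates on `i`, `j` and on `j`, `k` form a brickwork on three sites. -/
theorem gateFixes_trans (hf : 0 < fComplete N t d) {x : MomentSpace t (Fin N → Fin d)}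
    {i j k : Fin N} (hij : GateFixes x i j) (hjk : GateFixes x j k) : GateFixes x i k := by
  by_cases h1 : i = j
  · rwa [h1]
  by_cases h2 : j = k
  · rwa [← h2]
  by_cases h3 : i = k
  · rw [h3]; exact gateFixes_self x k
  have he : Function.Injective ![i, j, k] := by
    intro a b
    fin_cases a <;> fin_cases b <;> simp [h1, h2, h3, Ne.symm h1, Ne.symm h2, Ne.symm h3]
  have hN : 3 ≤ N := by simpa using Fintype.card_le_of_injective _ he
  have hx := gateInvariants_map_path_le he (x := x)
    (hf.trans_le (fComplete_le (m := 3) (by omega) hN)) ⟨?_, ?_⟩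
  · exact mem_gateInvariants.1 hx i k ⟨0, 2, trivial, rfl, rfl⟩
  · rw [SetLike.mem_coe, mem_gateInvariants]
    rintro _ _ ⟨a, b, ⟨hab, ha⟩, rfl, rfl⟩
    have ha1 : a = 1 := by apply Fin.ext; simp; omega
    have hb : b = 2 := by subst ha1; apply Fin.ext; simp at hab ⊢; omega
    subst ha1 hb
    exact hjk
  · rw [SetLike.mem_coe, mem_gateInvariants]
    rintro _ _ ⟨a, b, ⟨hab, ha⟩, rfl, rfl⟩
    have ha1 : a = 0 := by apply Fin.ext; simp; omega
    have hb : b = 1 := by subst ha1; apply Fin.ext; simp at hab ⊢; omega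
    subst ha1 hb
    exact hij

/-- The pairs of sites all of whose gates fix the vector `x`; transitivity is the case of three
sites of the path. -/
def fixSetoid (hf : 0 < fComplete N t d) (x : MomentSpace t (Fin N → Fin d)) : Setoid (Fin N) where
  r := GateFixes x
  iseqv := ⟨gateFixes_self x, GateFixes.symm, gateFixes_trans hf⟩

theorem mem_gateInvariants_setoid (hf : 0 < fComplete N t d) {s : Setoid (Fin N)}
    {x : MomentSpace t (Fin N → Fin d)} : x ∈ gateInvariants t d s ↔ s ≤ fixSetoid hf x :=
  mem_gateInvariants

end Gaps

/-! ### Gaps from alternating paths -/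

section Pairings

variable {N d t : ℕ}

/-- The relation `r`, restricted to a set of equivalence classes. -/
def onClasses (s : Setoid (Fin N)) (S : Set (Quotient s)) (r : Fin N → Fin N → Prop)
    (i j : Fin N) : Prop :=
  r i j ∧ (Quotient.mk s i : Quotient s) ∈ S

theorem siteDisjoint_onClasses {s : Setoid (Fin N)} {S T : Set (Quotient s)} (hST : Disjoint S T)
    {r r' : Fin N → Fin N → Prop} (hr : ∀ i j, r i j → s i j) (hr' : ∀ i j, r' i j → s i j) :
    SiteDisjoint (onClasses s S r) (onClasses s T r') := by
  rintro i j k l ⟨hij, hi⟩ ⟨hkl, hk⟩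
  have hj : (Quotient.mk s j : Quotient s) ∈ S := Quotient.sound (hr i j hij) ▸ hi
  have hl : (Quotient.mk s l : Quotient s) ∈ T := Quotient.sound (hr' k l hkl) ▸ hk
  have key : ∀ a b : Fin N, (Quotient.mk s a : Quotient s) ∈ S →
      (Quotient.mk s b : Quotient s) ∈ T → a ≠ b := by
    rintro a b ha hb rfl
    exact Set.disjoint_left.1 hST ha hb
  exact ⟨key _ _ hi hk, key _ _ hi hl, key _ _ hj hk, key _ _ hj hl⟩

theorem gateProj_onClasses_insert {s : Setoid (Fin N)} {S : Set (Quotient s)} {c : Quotient s}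
    (hc : c ∉ S) {r : Fin N → Fin N → Prop} (hr : ∀ i j, r i j → s i j) :
    gateProj t d (onClasses s (insert c S) r) =
      gateProj t d (onClasses s {c} r) * gateProj t d (onClasses s S r) := by
  rw [(siteDisjoint_onClasses (Set.disjoint_singleton_left.2 hc) hr hr).gateProj_mul]
  refine gateProj_congr fun i j => ?_
  simp only [onClasses, Set.mem_insert_iff, Set.mem_singleton_iff, and_or_left]

theorem fComplete_le_one (hN : 2 ≤ N) : fComplete N t d ≤ 1 :=
  (fComplete_le le_rfl hN).trans (spectralGap_le_one _)

/-- On a single orbit of two involutions the gap is the one of a brickwork. -/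
theorem norm_onClasses_singleton_le (hN : 2 ≤ N) (hf : 0 < fComplete N t d) {α β : Fin N → Fin N}
    (hα : Function.Involutive α) (hβ : Function.Involutive β) (x₀ : Fin N) :
    ‖gateProj t d (onClasses (link α β) {Quotient.mk _ x₀} fun i j => α i = j) *
        gateProj t d (onClasses (link α β) {Quotient.mk _ x₀} fun i j => β i = j) -
      gateProj t d (onClasses (link α β) {Quotient.mk _ x₀} (link α β))‖ ≤
      1 - fComplete N t d := by
  obtain ⟨a, b, m, e, hab, he, hrange, hstep⟩ := exists_alternating_path hα hβ x₀
  have hclass : ∀ i, (Quotient.mk (link α β) i : Quotient (link α β)) ∈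
      ({Quotient.mk _ x₀} : Set (Quotient (link α β))) ↔ link α β x₀ i := fun i => by
    rw [Set.mem_singleton_iff]
    exact Quotient.eq.trans ⟨fun h => (link α β).symm' h, fun h => (link α β).symm' h⟩
  have hαJ : ∀ i j, onClasses (link α β) {Quotient.mk _ x₀} (fun i j => α i = j) i j →
      onClasses (link α β) {Quotient.mk _ x₀} (link α β) i j := by
    rintro i _ ⟨rfl, h⟩
    exact ⟨link_left α β i, h⟩
  have hβJ : ∀ i j, onClasses (link α β) {Quotient.mk _ x₀} (fun i j => β i = j) i j →
      onClasses (link α β) {Quotient.mk _ x₀} (link α β) i j := by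
    rintro i _ ⟨rfl, h⟩
    exact ⟨link_right α β i, h⟩
  have hJ : ∀ i j, onClasses (link α β) {Quotient.mk _ x₀} (link α β) i j ↔
      Relation.Map (fun _ _ => True) e e i j := by
    intro i j
    simp only [onClasses, hclass]
    constructor
    · rintro ⟨hij, hi⟩
      obtain ⟨k, rfl⟩ := (hrange i).1 hi
      obtain ⟨l, rfl⟩ := (hrange j).1 ((link α β).trans' hi hij)
      exact ⟨k, l, trivial, rfl, rfl⟩
    · rintro ⟨k, l, -, rfl, rfl⟩
      have h1 := (hrange (e k)).2 ⟨k, rfl⟩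
      have h2 := (hrange (e l)).2 ⟨l, rfl⟩
      exact ⟨(link α β).trans' ((link α β).symm' h1) h2, h1⟩
  have hpath0 : ∀ i j, Relation.Map (pathRel m 0) e e i j →
      a i = j ∧ (Quotient.mk (link α β) i : Quotient (link α β)) ∈
      ({Quotient.mk _ x₀} : Set (Quotient (link α β))) := by
    rintro _ _ ⟨k, l, ⟨hkl, hk⟩, rfl, rfl⟩
    refine ⟨?_, (hclass _).2 ((hrange _).2 ⟨k, rfl⟩)⟩
    have h := hstep k (by omega)
    rw [if_pos (Nat.even_iff.2 hk)] at h
    rw [← h]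
    exact congrArg e (Fin.ext hkl)
  have hpath1 : ∀ i j, Relation.Map (pathRel m 1) e e i j →
      b i = j ∧ (Quotient.mk (link α β) i : Quotient (link α β)) ∈
      ({Quotient.mk _ x₀} : Set (Quotient (link α β))) := by
    rintro _ _ ⟨k, l, ⟨hkl, hk⟩, rfl, rfl⟩
    refine ⟨?_, (hclass _).2 ((hrange _).2 ⟨k, rfl⟩)⟩
    have h := hstep k (by omega)
    rw [if_neg (by rw [Nat.even_iff]; omega)] at h
    rw [← h]
    exact congrArg e (Fin.ext hkl)
  rcases lt_or_ge m 2 with hm | hm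
  · have hone : ∀ i j, onClasses (link α β) {Quotient.mk _ x₀} (link α β) i j → i = j := by
      intro i j h
      obtain ⟨k, l, -, rfl, rfl⟩ := (hJ i j).1 h
      exact congrArg e (Fin.ext (by omega))
    rw [gateProj_eq_one hone, gateProj_eq_one fun i j h => hone i j (hαJ i j h),
      gateProj_eq_one fun i j h => hone i j (hβJ i j h), mul_one, sub_self, norm_zero, sub_nonneg]
    exact fComplete_le_one hN
  · have hmN : m ≤ N := by simpa using Fintype.card_le_of_injective _ he
    have hle := fComplete_le (t := t) (d := d) hm hmN
    have hgap := hf.trans_le hle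
    rcases hab with ⟨rfl, rfl⟩ | ⟨rfl, rfl⟩
    · refine norm_gateProj_mul_sub_mono hpath0 hpath1 hαJ hβJ ?_
      rw [gateProj_congr hJ]
      exact (norm_path_sub_le' he hgap).trans (by linarith)
    · refine norm_gateProj_mul_sub_mono hpath1 hpath0 hαJ hβJ ?_
      rw [gateProj_congr hJ]
      exact (norm_path_sub_le he hgap).trans (by linarith)

/-- Two layers of disjoint pairs: the orbits are independent of each other, so that the gap is the
smallest one of the orbits. -/
theorem norm_involutions_le (hN : 2 ≤ N) (hf : 0 < fComplete N t d) {α β : Fin N → Fin N}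
    (hα : Function.Involutive α) (hβ : Function.Involutive β) :
    ‖gateProj t d (fun i j => α i = j) * gateProj t d (fun i j => β i = j) -
      gateProj t d (link α β)‖ ≤ 1 - fComplete N t d := by
  have hαJ : ∀ i j, α i = j → link α β i j := by
    rintro i _ rfl
    exact link_left α β i
  have hβJ : ∀ i j, β i = j → link α β i j := by
    rintro i _ rfl
    exact link_right α β i
  have hJJ : ∀ i j, link α β i j → link α β i j := fun _ _ h => h
  have key : ∀ S : Set (Quotient (link α β)),
      ‖gateProj t d (onClasses (link α β) S fun i j => α i = j) *
        gateProj t d (onClasses (link α β) S fun i j => β i = j) -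
      gateProj t d (onClasses (link α β) S (link α β))‖ ≤ 1 - fComplete N t d := by
    intro S
    induction S, S.toFinite using Set.Finite.induction_on with
    | empty =>
      have h : ∀ (r : Fin N → Fin N → Prop) i j, onClasses (link α β) ∅ r i j → i = j :=
        fun r i j h => h.2.elim
      rw [gateProj_eq_one (h _), gateProj_eq_one (h _), gateProj_eq_one (h _), mul_one, sub_self,
        norm_zero, sub_nonneg]
      exact fComplete_le_one hN
    | @insert c S hc _ ih =>
      obtain ⟨x₀, rfl⟩ := Quotient.exists_rep c
      have hd := Set.disjoint_singleton_left.2 hc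
      have comm := fun r r' hr hr' =>
        (siteDisjoint_onClasses (r := r) (r' := r') hd hr hr').commute (d := d) (t := t)
      have hle : ∀ (T : Set (Quotient (link α β))) r, (∀ i j, r i j → link α β i j) →
          gateInvariants t d (onClasses _ T (link α β)) ≤ gateInvariants t d (onClasses _ T r) :=
        fun T r hr => gateInvariants_anti fun i j h => ⟨hr i j h.1, h.2⟩
      rw [gateProj_onClasses_insert hc hαJ, gateProj_onClasses_insert hc hβJ,
        gateProj_onClasses_insert hc hJJ, (comm _ _ hβJ hαJ).symm.mul_mul_mul_comm]
      refine norm_mul_sub_mul_le (sub_nonneg.2 (fComplete_le_one hN)) ?_ ?_ (comm _ _ hJJ hJJ)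
        ?_ ?_ ?_ (norm_onClasses_singleton_le hN hf hα hβ x₀) ih
      · exact ((comm _ _ hαJ hαJ).mul_left (comm _ _ hβJ hαJ)).mul_right
          ((comm _ _ hαJ hβJ).mul_left (comm _ _ hβJ hβJ))
      · exact (comm _ _ hJJ hαJ).mul_right (comm _ _ hJJ hβJ)
      · rw [mul_assoc]
        refine (congrArg _ (starProjection_mul_of_le (hle _ _ hβJ))).trans ?_
        exact starProjection_mul_of_le (hle _ _ hαJ)
      · rw [← mul_assoc]
        refine (congrArg (· * _) (starProjection_mul_of_ge (hle _ _ hαJ))).trans ?_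
        exact starProjection_mul_of_ge (hle _ _ hβJ)
      · exact (norm_mul_le _ _).trans (mul_le_one₀ (norm_starProjection_le_one _) (norm_nonneg _)
          (norm_starProjection_le_one _))
  have huniv : ∀ r, gateProj t d (onClasses (link α β) Set.univ r) = gateProj t d r :=
    fun r => gateProj_congr fun i j => and_iff_left (Set.mem_univ _)
  simpa only [huniv] using key Set.univ

theorem gateInvariants_le_of_le {s s' : Setoid (Fin N)} (h : s ≤ s') :
    gateInvariants t d s' ≤ gateInvariants t d s :=
  gateInvariants_anti fun _ _ hij => h hij

/-- Two partitions with pairings that leave out few sites have the gap of a pair of involutions. -/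
theorem norm_sup_le_of_fixedIn (hN : 2 ≤ N) (hf : 0 < fComplete N t d) {p q : Setoid (Fin N)}
    {α₀ β₀ : Fin N → Fin N} (hα₀ : Function.Involutive α₀) (hβ₀ : Function.Involutive β₀)
    (hαp : ∀ x, p x (α₀ x)) (hβq : ∀ x, q x (β₀ x))
    (hC : ∀ x, (fixedIn (p ⊔ q) α₀ x).card + (fixedIn (p ⊔ q) β₀ x).card ≤ 3) :
    ‖gateProj t d p * gateProj t d q - gateProj t d ↑(p ⊔ q)‖ ≤ 1 - fComplete N t d := by
  obtain ⟨α, β, hα, hβ, hp, hq, h⟩ := exists_link_eq_sup hα₀ hβ₀ hαp hβq hC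
  refine norm_gateProj_mul_sub_mono (p' := fun i j => α i = j) (q' := fun i j => β i = j)
    ?_ ?_ (fun i j hij => le_sup_left (a := p) (b := q) hij)
    (fun i j hij => le_sup_right (a := p) (b := q) hij) ?_
  · rintro i _ rfl
    exact hp i
  · rintro i _ rfl
    exact hq i
  · rw [← h]
    exact norm_involutions_le hN hf hα hβ

theorem gateInvariants_link_id (hf : 0 < fComplete N t d) (α : Fin N → Fin N) :
    gateInvariants t d (link α id) = gateInvariants t d fun i j => α i = j := by
  refine le_antisymm (gateInvariants_anti ?_) fun x hx => ?_
  · rintro i _ rfl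
    exact link_left α id i
  · rw [mem_gateInvariants_setoid hf]
    exact link_le (fun i => mem_gateInvariants.1 hx i _ rfl) fun i => gateFixes_self x i

/-- For an arbitrary pair of partitions, one of them into pairs, three re-pairings of the sites
are enough, whence the third power. -/
theorem norm_link_sup_le (hN : 2 ≤ N) (hf : 0 < fComplete N t d) {α : Fin N → Fin N}
    (hα : Function.Involutive α) (q : Setoid (Fin N)) :
    ‖gateProj t d (link α id) * gateProj t d q - gateProj t d ↑(link α id ⊔ q)‖ ≤
      1 - fComplete N t d ^ 3 := by
  obtain ⟨β, γ, α', hβ, hγ, hα', hβq, hγl, hαl, hfix₁, hfix₂⟩ := exists_three_pairings hα q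
  have hf₁ := fComplete_le_one (t := t) (d := d) hN
  set f := fComplete N t d with hfdef
  have hγl' : link γ id ≤ link α β := link_le hγl fun x => (link α β).refl' x
  have hsup : link α β ⊔ (link γ id ⊔ q) = link α id ⊔ q := by
    refine le_antisymm (sup_le ?_ (sup_le (hγl'.trans ?_) le_sup_right))
      (sup_le ((link_le (link_left _ _) fun x => (link α β).refl' x).trans le_sup_left)
        (le_sup_right.trans le_sup_right))
    all_goals exact link_le (fun x => le_sup_left (a := link α id) (link_left α id x))
                (fun x => le_sup_right (a := link α id) (hβq x))
  have hβq' : ∀ i j, β i = j → q i j := by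
    rintro i _ rfl
    exact hβq i
  have hαl' : ∀ i j, α i = j → link α β i j := by
    rintro i _ rfl
    exact link_left α β i
  have hβl' : ∀ i j, β i = j → link α β i j := by
    rintro i _ rfl
    exact link_right α β i
  -- The pairing `γ` and the partition `q`, followed by the orbits of `α` and `β`.
  have h₂ : ‖gateProj t d (link α β) * gateProj t d q - gateProj t d ↑(link α id ⊔ q)‖ ≤
      1 - f * f := by
    have e : gateProj t d (link α β) * gateProj t d q =
        gateProj t d (link α β) * (gateProj t d (link γ id) * gateProj t d q) := by
      rw [← mul_assoc]
      exact congrArg (· * _) (starProjection_mul_of_ge (gateInvariants_le_of_le hγl')).symm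
    rw [e]
    refine norm_mul_sub_le_of_right (K := gateInvariants t d ↑(link γ id ⊔ q)) hf.le hf₁ ?_ ?_
      (gateInvariants_le_of_le (hsup ▸ le_sup_right)) ?_ (norm_starProjection_le_one _)
      (starProjection_mul_of_le (gateInvariants_le_of_le (hsup ▸ le_sup_left))) ?_
    · rw [mul_assoc]
      refine (congrArg _ (starProjection_mul_of_le (gateInvariants_le_of_le le_sup_right))).trans ?_
      exact starProjection_mul_of_le (gateInvariants_le_of_le le_sup_left)
    · rw [← mul_assoc]
      refine (congrArg (· * _)
        (starProjection_mul_of_ge (gateInvariants_le_of_le le_sup_left))).trans ?_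
      exact starProjection_mul_of_ge (gateInvariants_le_of_le le_sup_right)
    · exact norm_sup_le_of_fixedIn hN hf hγ hβ (link_left γ id) hβq hfix₁
    · rw [← hsup]
      exact norm_sup_le_of_fixedIn hN hf hα' hγ hαl
        (fun x => le_sup_left (a := link γ id) (link_left γ id x)) hfix₂
  have e : gateProj t d (link α id) * gateProj t d q =
      gateProj t d (fun i j => α i = j) * gateProj t d (fun i j => β i = j) * gateProj t d q := by
    rw [mul_assoc]
    refine congrArg₂ _ ?_ (starProjection_mul_of_le (gateInvariants_anti hβq')).symm
    simp only [gateProj, gateInvariants_link_id hf]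
  rw [e, show f ^ 3 = f * (f * f) by ring]
  refine norm_mul_sub_le_of_left (K := gateInvariants t d (link α β)) hf.le hf₁ ?_ ?_
    (gateInvariants_le_of_le (hsup ▸ le_sup_left)) (norm_involutions_le hN hf hα hβ)
    (norm_starProjection_le_one _)
    (starProjection_mul_of_ge (gateInvariants_le_of_le le_sup_right)) h₂
  · rw [mul_assoc]
    refine (congrArg _ (starProjection_mul_of_le (gateInvariants_anti hβl'))).trans ?_
    exact starProjection_mul_of_le (gateInvariants_anti hαl')
  · rw [← mul_assoc]
    refine (congrArg (· * _) (starProjection_mul_of_ge (gateInvariants_anti hαl'))).trans ?_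
    exact starProjection_mul_of_ge (gateInvariants_anti hβl')

end Pairings

/-! ### Layers of an architecture as partitions of the sites -/

section Layers

variable {N d t l : ℕ}

/-- The involution of the sites that swaps the two sites of each gate of the layer. -/
noncomputable def Layer.partner (L : Layer N) : Fin N → Fin N :=
  Function.extend L.site (fun p => L.site (p.1, p.2.rev)) id

theorem Layer.partner_site (L : Layer N) (p : Fin L.numGates × Fin 2) :
    L.partner (L.site p) = L.site (p.1, p.2.rev) :=
  L.site_injective.extend_apply _ _ p

theorem Layer.partner_of_notMem (L : Layer N) {x : Fin N} (hx : x ∉ Set.range L.site) :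
    L.partner x = x :=
  Function.extend_apply' _ _ x hx

theorem Layer.involutive_partner (L : Layer N) : Function.Involutive L.partner := by
  intro x
  by_cases hx : x ∈ Set.range L.site
  · obtain ⟨p, rfl⟩ := hx
    rw [L.partner_site, L.partner_site, Fin.rev_rev]
  · rw [L.partner_of_notMem hx, L.partner_of_notMem hx]

theorem Layer.notMem_range_of_partner_eq (L : Layer N) {x : Fin N} (h : L.partner x = x) :
    x ∉ Set.range L.site := by
  rintro ⟨p, rfl⟩
  rw [L.partner_site] at h
  have h1 : p.2.rev = p.2 := congrArg Prod.snd (L.site_injective h)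
  have h2 := congrArg Fin.val h1
  rw [Fin.val_rev] at h2
  omega

theorem Layer.card_fixedIn_partner_le (L : Layer N) (h : L.numGates = N / 2) (s : Setoid (Fin N))
    (x : Fin N) : (fixedIn s L.partner x).card ≤ 1 := by
  classical
  have h1 : fixedIn s L.partner x ⊆ (Finset.univ.image L.site)ᶜ := fun z hz => by
    have := L.notMem_range_of_partner_eq (mem_fixedIn.1 hz).2
    simpa using this
  have h2 := Finset.card_le_card h1
  rw [Finset.card_compl, Finset.card_image_of_injective _ L.site_injective, Finset.card_univ,
    Fintype.card_prod, Fintype.card_fin, Fintype.card_fin, Fintype.card_fin, h] at h2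
  omega

/-- The partition of the sites into the pairs of the gates and single sites. -/
noncomputable def Layer.setoid (L : Layer N) : Setoid (Fin N) := link L.partner id

theorem Layer.setoid_of_gateRel (L : Layer N) {i j : Fin N} (h : gateRel L.site i j) :
    L.setoid i j := by
  obtain ⟨g, rfl, rfl⟩ := h
  have := link_left L.partner id (L.site (g, 0))
  rwa [L.partner_site] at this

theorem Layer.setoid_le (L : Layer N) {s : Setoid (Fin N)}
    (h : ∀ i j, gateRel L.site i j → s i j) : L.setoid ≤ s := by
  refine link_le (fun x => ?_) s.refl'
  by_cases hx : x ∈ Set.range L.site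
  · obtain ⟨⟨g, b⟩, rfl⟩ := hx
    rw [L.partner_site]
    have h1 : s (L.site (g, 0)) (L.site (g, 1)) := h _ _ ⟨g, rfl, rfl⟩
    fin_cases b
    exacts [h1, s.symm' h1]
  · rw [L.partner_of_notMem hx]

theorem Layer.gateInvariants_setoid (hf : 0 < fComplete N t d) (L : Layer N) :
    gateInvariants t d L.setoid = gateInvariants t d (gateRel L.site) := by
  refine le_antisymm (gateInvariants_anti fun i j => L.setoid_of_gateRel) fun x hx => ?_
  rw [mem_gateInvariants_setoid hf]
  exact L.setoid_le (mem_gateInvariants.1 hx)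

theorem Layer.gateProj_setoid (hf : 0 < fComplete N t d) (L : Layer N) :
    gateProj t d L.setoid = gateProj t d (gateRel L.site) := by
  simp only [gateProj, L.gateInvariants_setoid hf]

theorem norm_gateProj_mul_sub_eq_zero {p q : Setoid (Fin N)} (h : p ≤ q ∨ q ≤ p) :
    ‖gateProj t d p * gateProj t d q - gateProj t d ↑(p ⊔ q)‖ = 0 := by
  rw [norm_eq_zero, sub_eq_zero]
  rcases h with h | h
  · rw [sup_eq_right.2 h]
    exact starProjection_mul_of_le (gateInvariants_le_of_le h)
  · rw [sup_eq_left.2 h]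
    exact starProjection_mul_of_ge (gateInvariants_le_of_le h)

/-- A maximal layer, combined with a partition that contains a maximal layer: each of the two
pairings leaves out at most one site. -/
theorem Layer.norm_sup_le_of_complete (hN : 2 ≤ N) (hf : 0 < fComplete N t d) {L L' : Layer N}
    (hL : L.numGates = N / 2) (hL' : L'.numGates = N / 2) {s : Setoid (Fin N)}
    (hs : L'.setoid ≤ s) :
    ‖gateProj t d L.setoid * gateProj t d s - gateProj t d ↑(L.setoid ⊔ s)‖ ≤
      1 - fComplete N t d :=
  norm_sup_le_of_fixedIn hN hf L.involutive_partner L'.involutive_partner (link_left _ _)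
    (fun x => hs (link_left L'.partner id x)) fun x =>
    (add_le_add (L.card_fixedIn_partner_le hL _ x)
      (L'.card_fixedIn_partner_le hL' _ x)).trans (by norm_num)

theorem le_or_le_of_fin_two (p q : Setoid (Fin 2)) : p ≤ q ∨ q ≤ p := by
  have key : ∀ {r : Setoid (Fin 2)}, r 0 1 → ∀ x y, r x y := fun {r} h x y => by
    fin_cases x <;> fin_cases y
    exacts [r.refl' _, h, r.symm' h, r.refl' _]
  by_cases h : p 0 1
  · exact Or.inr fun {x y} _ => key h x y
  · refine Or.inl fun {x y} hxy => ?_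
    fin_cases x <;> fin_cases y
    exacts [q.refl' _, (h hxy).elim, (h (p.symm' hxy)).elim, q.refl' _]

theorem three_le_hExponent (hN : 3 ≤ N) : 3 ≤ hExponent N := by
  have h1 : 2 ≤ Nat.log 2 (N + 1) := Nat.le_log_of_pow_le (by norm_num) (by omega)
  have h2 : 0 < Nat.clog 2 (Nat.log 2 (N + 1)) := Nat.clog_pos (by norm_num) h1
  rw [hExponent]
  omega

theorem Layer.norm_sup_le (hN : 2 ≤ N) (hf : 0 < fComplete N t d) (L : Layer N)
    (s : Setoid (Fin N)) :
    ‖gateProj t d L.setoid * gateProj t d s - gateProj t d ↑(L.setoid ⊔ s)‖ ≤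
      1 - fIncomplete N t d := by
  have hf₁ := fComplete_le_one (t := t) (d := d) hN
  -- The exponent is `1` for two sites, where all partitions are comparable.
  rcases hN.eq_or_lt with rfl | hN'
  · rw [norm_gateProj_mul_sub_eq_zero (le_or_le_of_fin_two _ _), sub_nonneg]
    exact pow_le_one₀ hf.le hf₁
  · refine (norm_link_sup_le hN hf L.involutive_partner s).trans (sub_le_sub_left ?_ _)
    exact pow_le_pow_of_le_one hf.le hf₁ (three_le_hExponent hN')

namespace Architecture

/-- The partition of the sites generated by the gates of all layers. -/
noncomputable def setoid (A : Architecture N l) : Setoid (Fin N) := ⨆ j, (A j).setoid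

theorem setoid_succ (A : Architecture N (l + 1)) :
    A.setoid = (A (Fin.last l)).setoid ⊔ setoid fun j => A j.castSucc := by
  refine le_antisymm (iSup_le fun j => ?_)
    (sup_le (le_iSup (fun j => (A j).setoid) _)
      (iSup_le fun j => le_iSup (fun j => (A j).setoid) j.castSucc))
  induction j using Fin.lastCases with
  | last => exact le_sup_left
  | cast j => exact (le_iSup (fun j : Fin l => (A j.castSucc).setoid) j).trans le_sup_right

theorem setoid_one (A : Architecture N 1) : A.setoid = (A 0).setoid :=
  ciSup_unique

end Architecture

/-- Vectors fixed by all gates of the circuit are fixed by its moment operator and by the adjoint. -/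
theorem average_composition_mul_gateProj (A : Architecture N l) (ν : A.GateEnsembles d)
    {r : Fin N → Fin N → Prop}
    (hr : ∀ j, gateInvariants t d r ≤ gateInvariants t d (gateRel (A j).site)) :
    average t (composition fun j => (A j).ensemble (ν j)) id * gateProj t d r = gateProj t d r ∧
    gateProj t d r * average t (composition fun j => (A j).ensemble (ν j)) id =
      gateProj t d r := by
  induction l with
  | zero => rw [average_composition_zero, one_mul, mul_one, and_self]
  | succ l ih =>
    obtain ⟨h1, h2⟩ := ih (fun j => A j.castSucc) (fun j => ν j.castSucc) fun j => hr _
    rw [average_composition_succ _ fun j => (A j).isProbabilityMeasure_ensemble (ν j)]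
    constructor
    · rw [mul_assoc, h1, Layer.average_mul_gateProj _ _ (hr _)]
    · rw [← mul_assoc, Layer.gateProj_mul_average _ _ (hr _), h2]

theorem average_composition_one (A : Architecture N 1) (ν : A.GateEnsembles d) :
    average t (composition fun j => (A j).ensemble (ν j)) id =
      average t ((A 0).ensemble (ν 0)) id := by
  rw [average_composition_succ _ fun j => (A j).isProbabilityMeasure_ensemble (ν j),
    average_composition_zero, mul_one]
  rfl

/-- The gaps of the layers and the gaps between each layer and the partition generated by the
previous layers multiply. -/
theorem norm_average_composition_sub_le (hf : 0 < fComplete N t d) {C : Layer N → Prop} {Δ g : ℝ}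
    (hΔ₀ : 0 ≤ Δ) (hΔ₁ : Δ ≤ 1) (hg₀ : 0 ≤ g) (hg₁ : g ≤ 1)
    (hC : ∀ {L L' : Layer N} {s : Setoid (Fin N)}, C L → C L' → L'.setoid ≤ s →
      ‖gateProj t d L.setoid * gateProj t d s - gateProj t d ↑(L.setoid ⊔ s)‖ ≤ 1 - g)
    (A : Architecture N (l + 1)) (ν : A.GateEnsembles d) (hA : ∀ j, C (A j))
    (hν : ∀ j i, Δ ≤ spectralGap t (ν j i : Measure (U (Fin d × Fin d)))) :
    ‖average t (composition fun j => (A j).ensemble (ν j)) id - gateProj t d A.setoid‖ ≤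
      1 - Δ ^ (l + 1) * g ^ l := by
  have hlayer : ∀ j, ‖average t ((A j).ensemble (ν j)) id - gateProj t d (A j).setoid‖ ≤
      1 - Δ := fun j => by
    rw [Layer.gateProj_setoid hf]
    exact (A j).norm_average_ensemble_sub_le _ (sub_nonneg.2 hΔ₁) fun i => by linarith [hν j i]
  induction l with
  | zero =>
    rw [average_composition_one, A.setoid_one, zero_add, pow_one, pow_zero, mul_one]
    exact hlayer 0
  | succ l ih =>
    set B : Architecture N (l + 1) := fun j => A j.castSucc with hB
    have := fun j => (A j).isProbabilityMeasure_ensemble (ν j)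
    have hle : ∀ {L : Layer N} {s : Setoid (Fin N)}, L.setoid ≤ s →
        gateInvariants t d s ≤ gateInvariants t d (gateRel L.site) := fun {L s} h =>
      (gateInvariants_le_of_le h).trans_eq (L.gateInvariants_setoid hf)
    -- The last layer is replaced by its projection, then the earlier layers by theirs.
    have hstep : ‖average t ((A (Fin.last _)).ensemble (ν (Fin.last _))) id *
        gateProj t d B.setoid - gateProj t d A.setoid‖ ≤ 1 - Δ * g := by
      refine norm_mul_sub_le_of_left (K := gateInvariants t d (A (Fin.last _)).setoid) hΔ₀ hΔ₁
        (Layer.average_mul_gateProj _ _ (hle le_rfl)) (Layer.gateProj_mul_average _ _ (hle le_rfl))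
        (gateInvariants_le_of_le (A.setoid_succ ▸ le_sup_left)) (hlayer _)
        (norm_starProjection_le_one _)
        (starProjection_mul_of_ge (gateInvariants_le_of_le (A.setoid_succ ▸ le_sup_right))) ?_
      rw [A.setoid_succ]
      exact hC (hA _) (hA (Fin.castSucc 0)) (le_iSup (fun j => (B j).setoid) 0)
    obtain ⟨h1, h2⟩ := average_composition_mul_gateProj (t := t) B (fun j => ν j.castSucc)
      (r := B.setoid) fun j => hle (le_iSup (fun j => (B j).setoid) j)
    rw [average_composition_succ _ this,
      show Δ ^ (l + 1 + 1) * g ^ (l + 1) = Δ ^ (l + 1) * g ^ l * (Δ * g) by ring]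
    exact norm_mul_sub_le_of_right (K := gateInvariants t d B.setoid) (by positivity)
      (mul_le_one₀ (pow_le_one₀ hΔ₀ hΔ₁) (by positivity) (pow_le_one₀ hg₀ hg₁)) h1 h2
      (gateInvariants_le_of_le (A.setoid_succ ▸ le_sup_right))
      (ih B _ (fun j => hA _) (fun j => hν _) fun j => hlayer _)
      (norm_average_le _)
      (Layer.average_mul_gateProj _ _ (hle (le_iSup (fun j => (A j).setoid) _))) hstep

end Layers

/-! ### Connected blocks -/

section Connected

variable {N d t l : ℕ}

theorem Architecture.IsConnectedBlock.forall_setoid {A : Architecture N l}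
    (hA : A.IsConnectedBlock) {s : Setoid (Fin N)}
    (h : ∀ j x y, gateRel (A j).site x y → s x y) (x y : Fin N) : s x y := by
  obtain ⟨w⟩ := SimpleGraph.Connected.preconnected hA x y
  induction w with
  | nil => exact s.refl' _
  | cons hadj _ ih =>
    refine s.trans' ?_ ih
    rcases (SimpleGraph.fromRel_adj _ _ _).1 hadj with ⟨-, ⟨j, g, hg⟩ | ⟨j, g, hg⟩⟩
    · exact h j _ _ ⟨g, hg⟩
    · exact s.symm' (h j _ _ ⟨g, hg⟩)

theorem Architecture.IsConnectedBlock.setoid_eq_top {A : Architecture N l}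
    (hA : A.IsConnectedBlock) : A.setoid = ⊤ :=
  top_le_iff.1 fun {x y} _ => hA.forall_setoid
    (fun j _ _ h => le_iSup (fun j => (A j).setoid) j ((A j).setoid_of_gateRel h)) x y

theorem Architecture.IsConnectedBlock.exists_gate {A : Architecture N l}
    (hA : A.IsConnectedBlock) (hN : 2 ≤ N) : ∃ j, Nonempty (Fin (A j).numGates) := by
  by_contra! h
  have := hA.forall_setoid (s := ⊥) (fun j x y ⟨g, _⟩ => ((h j).false g).elim)
    ⟨0, by omega⟩ ⟨1, by omega⟩
  exact absurd (congrArg Fin.val (this : (_ : Fin N) = _)) (by norm_num)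

theorem gateInvariants_top (hN : 2 ≤ N) (hf : 0 < fComplete N t d) :
    gateInvariants t d (⊤ : Setoid (Fin N)) = invariants t Set.univ :=
  le_antisymm ((le_inf (gateInvariants_anti fun _ _ _ => trivial)
    (gateInvariants_anti fun _ _ _ => trivial)).trans
      (gateInvariants_path_le (hf.trans_le (fComplete_le hN le_rfl)))) (invariants_univ_le _)

/-- If `i` and `j` are the only sites, then each unitary is a gate on `i` and `j`. -/
theorem exists_eq_embedGate {i j : Fin N} (hij : i ≠ j) (h : ∀ k, k = i ∨ k = j)
    (V : U (Fin N → Fin d)) : ∃ u, V = embedGate i j hij u := by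
  have : IsEmpty {k : Fin N // ∀ a, ![i, j] a ≠ k} := ⟨fun k => by
    rcases h k with hk | hk
    exacts [k.2 0 hk.symm, k.2 1 hk.symm]⟩
  refine ⟨reindexUnitary ((pairEquiv d hij).trans (Equiv.prodUnique _ _)).symm V, ?_⟩
  ext a b
  rw [isAmplification_embedGate hij _ a b, if_pos (Subsingleton.elim _ _)]
  have key : ∀ a, ((pairEquiv d hij).trans (Equiv.prodUnique _ _)).symm (pairEquiv d hij a).1 = a :=
    fun a => (Equiv.symm_apply_eq _).2 rfl
  change V.1 a b = V.1 (_) (_)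
  rw [key, key]

/-- A single layer is connected only if there are two sites, joined by a gate. -/
theorem Architecture.IsConnectedBlock.gateInvariants_eq {A : Architecture N 1}
    (hA : A.IsConnectedBlock) (hN : 2 ≤ N) :
    gateInvariants t d (gateRel (A 0).site) = invariants t Set.univ := by
  obtain ⟨j, ⟨g⟩⟩ := hA.exists_gate hN
  obtain rfl := Subsingleton.elim j 0
  refine le_antisymm (fun x hx V _ => ?_) (invariants_univ_le _)
  -- The two sites of the gate `g` are not joined to any other site.
  have key := hA.forall_setoid
    (s := Setoid.ker fun x => ∃ b, x = (A 0).site (g, b)) fun j x y => by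
      obtain rfl := Subsingleton.elim j 0
      rintro ⟨g', rfl, rfl⟩
      refine propext ⟨?_, ?_⟩ <;>
      · rintro ⟨b, hb⟩
        obtain rfl := congrArg Prod.fst ((A 0).site_injective hb)
        exact ⟨_, rfl⟩
  have hsites : ∀ k, k = (A 0).site (g, 0) ∨ k = (A 0).site (g, 1) := fun k => by
    obtain ⟨b, hb⟩ := (key k ((A 0).site (g, 0)) : (∃ b, _) = ∃ b, _).mpr ⟨0, rfl⟩
    fin_cases b
    exacts [Or.inl hb, Or.inr hb]
  obtain ⟨u, rfl⟩ := exists_eq_embedGate ((A 0).site_ne g) hsites V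
  exact mem_gateInvariants.1 hx _ _ ⟨g, rfl, rfl⟩ _ u

theorem localSpectralGap_nonneg (A : Architecture N l) (ν : A.GateEnsembles d) :
    0 ≤ localSpectralGap t A ν :=
  Real.iInf_nonneg fun _ => spectralGap_nonneg _

theorem localSpectralGap_le (A : Architecture N l) (ν : A.GateEnsembles d) (j : Fin l)
    (i : Fin (A j).numGates) :
    localSpectralGap t A ν ≤ spectralGap t (ν j i : Measure (U (Fin d × Fin d))) :=
  ciInf_le (f := fun g : (j : Fin l) × Fin (A j).numGates =>
    spectralGap t (ν g.1 g.2 : Measure (U (Fin d × Fin d)))) (Set.finite_range _).bddBelow ⟨j, i⟩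

theorem haarBrickworkGap_nonneg (m : ℕ) : 0 ≤ haarBrickworkGap t m d := by
  have := isProbabilityMeasure_composition
    (fun j => (brickwork m j).ensemble fun _ => haarEnsemble (Fin d × Fin d))
    fun j => Layer.isProbabilityMeasure_ensemble _ _
  exact spectralGap_nonneg (composition fun j =>
    (brickwork m j).ensemble fun _ => haarEnsemble (Fin d × Fin d))

theorem fComplete_nonneg : 0 ≤ fComplete N t d :=
  Real.iInf_nonneg fun _ => haarBrickworkGap_nonneg _

/-- The common form of the bounds for complete and for incomplete architectures. -/
theorem localSpectralGap_pow_mul_le (hN : 2 ≤ N) {A : Architecture N l} (hA : A.IsConnectedBlock)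
    (ν : A.GateEnsembles d) {C : Layer N → Prop} (hAC : ∀ j, C (A j)) {k : ℕ} (hk : k ≠ 0)
    (hC : 0 < fComplete N t d → ∀ {L L' : Layer N} {s : Setoid (Fin N)}, C L → C L' →
      L'.setoid ≤ s → ‖gateProj t d L.setoid * gateProj t d s - gateProj t d ↑(L.setoid ⊔ s)‖ ≤
        1 - fComplete N t d ^ k) :
    localSpectralGap t A ν ^ l * (fComplete N t d ^ k) ^ (l - 1) ≤
      spectralGap t (circuitEnsemble A ν) := by
  have hν := localSpectralGap_le (t := t) A ν
  have hΔ₀ := localSpectralGap_nonneg (t := t) A ν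
  obtain ⟨j, ⟨i⟩⟩ := hA.exists_gate hN
  have hΔ₁ := (hν j i).trans (spectralGap_le_one _)
  have := isProbabilityMeasure_composition (fun j => (A j).ensemble (ν j))
    fun j => (A j).isProbabilityMeasure_ensemble (ν j)
  change _ ≤ spectralGap t (composition fun j => (A j).ensemble (ν j))
  generalize localSpectralGap t A ν = Δ at hν hΔ₀ hΔ₁ ⊢
  obtain _ | _ | l := l
  · exact j.elim0
  -- A single layer: the exponent of `fComplete` is zero, so that no gap of a brickwork is available.
  · have e : Δ ^ (0 + 1) * (fComplete N t d ^ k) ^ (0 + 1 - 1) = Δ := by simp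
    rw [e, spectralGap_eq, average_composition_one, le_sub_comm]
    have h := (A 0).norm_average_ensemble_sub_le (t := t) (ν 0) (sub_nonneg.2 hΔ₁)
      fun i => by linarith [hν 0 i]
    simpa only [gateProj, hA.gateInvariants_eq hN] using h
  · rcases (fComplete_nonneg (N := N) (t := t) (d := d)).eq_or_lt with hf | hf
    · rw [← hf, zero_pow hk, zero_pow (by omega), mul_zero]
      exact spectralGap_nonneg _
    · have hf₁ := fComplete_le_one (t := t) (d := d) hN
      have h := norm_average_composition_sub_le hf hΔ₀ hΔ₁ (by positivity)
        (pow_le_one₀ hf.le hf₁) (hC hf) A ν hAC hν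
      rw [hA.setoid_eq_top] at h
      simp only [gateProj, gateInvariants_top hN hf] at h
      rw [spectralGap_eq, le_sub_comm]
      exact h

end Connected

end RandomCircuit

theorem mainTheorem4 (N d t l : ℕ) (hN : 2 ≤ N)
    (A : RandomCircuit.Architecture N l) (hA : A.IsConnectedBlock)
    (ν : A.GateEnsembles d) :
    (A.IsComplete →
      RandomCircuit.localSpectralGap t A ν ^ l * RandomCircuit.fComplete N t d ^ (l - 1) ≤
        RandomCircuit.spectralGap t (RandomCircuit.circuitEnsemble A ν)) ∧
    (¬ A.IsComplete →
      RandomCircuit.localSpectralGap t A ν ^ l * RandomCircuit.fIncomplete N t d ^ (l - 1) ≤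
        RandomCircuit.spectralGap t (RandomCircuit.circuitEnsemble A ν)) := by
  refine ⟨fun hc => ?_, fun _ => ?_⟩
  · have h := RandomCircuit.localSpectralGap_pow_mul_le (t := t) hN hA ν
      (C := fun L => L.numGates = N / 2) hc one_ne_zero fun hf {L L' s} hL hL' hs => by
        rw [pow_one]
        exact RandomCircuit.Layer.norm_sup_le_of_complete hN hf hL hL' hs
    rwa [pow_one] at h
  · exact RandomCircuit.localSpectralGap_pow_mul_le hN hA ν (C := fun _ => True)
      (fun _ => trivial) (Nat.succ_ne_zero _)
      fun hf {L _ s} _ _ _ => RandomCircuit.Layer.norm_sup_le hN hf L s
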